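/- Let $d\ge 1$, let $G\subset\mathbb R^d$ be a (Lebesgue measurable) set with nonempty interior, and let $r\in\mathbb N_0$. For $1\le p\le\infty$ let $W_p^r(G)$ be the Sobolev space of functions $f\in L_p(G)$ whose weak derivatives satisfy $$\|f\|_{W_p^r(G)}=\Bigl(\sum_{\alpha\in\mathbb N_0^d,\ |\alpha|_1\le r}\|D^\alpha f\|_{L_p(G)}^p\Bigr)^{1/p}<\infty$$ (a maximum if $p=\infty$; derivatives of positive order are taken on the interior of $G$), where only those $f$ are admitted as inputs for which $\operatorname{INT}f=\int_G f(x)\,dx$ exists. A randomized algorithm $A_n=(A_n^\omega)_{\omega\in\Omega}$ with $n$ function values is indexed by a probability space $(\Omega,\Sigma,\mathbb P)$; for each $\omega$ it observes $y_i=f(x_i^\omega)$, $i=1,\dots,n$, at points $x_i^\omega\in G$, where $x_i^\omega$ may depend on the previously observed values $y_1,\dots,y_{i-1}$ (adaptive algorithms are allowed), and returns $A_n^\omega(f)=\phi^\omega(y_1,\dots,y_n)$ with an arbitrary $\phi^\omega:\mathbb R^n\to\mathbb R$; the error $\omega\mapsto|A_n^\omega(f)-\operatorname{INT}f|$ is required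 to be measurable for every input $f$. Let $e^{\mathrm{MC}}_{\mathrm{prob}}(n,\delta,W_p^r(G))\in[0,\infty]$ be the infimum of all $\varepsilon>0$ for which there is such an algorithm with $$\mathbb P\{|A_n(f)-\operatorname{INT}f|>\varepsilon\}\le\delta\qquad\text{for all inputs } f \text{ with } \|f\|_{W_p^r(G)}\le 1.$$ Then there are $n_0\in\mathbb N$, $\delta_0\in(0,1)$ and $c>0$, depending only on $d$, $r$ and $G$, such that for all $1\le p\le\infty$, with $q:=\min\{p,2\}$, all $n\ge n_0$ and all $\delta\in(0,\delta_0)$, $$e^{\mathrm{MC}}_{\mathrm{prob}}(n,\delta,W_p^r(G))\ \ge\ c\,\min\Bigl\{n^{-r/d},\ n^{-(r/d+1-1/q)}\,(\log\delta^{-1})^{1-1/q}\Bigr\}.$$ The same bound holds if the inputs are restricted to the functions in $W_p^r(G)$ that are continuous on $G$. -/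

import Mathlib

open MeasureTheory Set
open scoped ENNReal

universe u

/-! ### Sobolev spaces of integer smoothness on subsets of `ℝ^d`

Points of `ℝ^d` are functions `Fin d → ℝ`; `volume` is the `d`-dimensional Lebesgue measure. -/

/-- The partial derivative `∂φ/∂x_i`. -/
noncomputable def partialD {d : ℕ} (i : Fin d) (φ : (Fin d → ℝ) → ℝ) : (Fin d → ℝ) → ℝ :=
  fun x => fderiv ℝ φ x (Pi.single i 1)

/-- The classical derivative `D^α φ = ∂_{x_1}^{α_1} ⋯ ∂_{x_d}^{α_d} φ` (used for smooth `φ`). -/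
noncomputable def multiD {d : ℕ} (α : Fin d → ℕ) (φ : (Fin d → ℝ) → ℝ) : (Fin d → ℝ) → ℝ :=
  (List.finRange d).foldr (fun i ψ => (partialD i)^[α i] ψ) φ

/-- The finite set of multi-indices `α ∈ ℕ_0^d` with `|α|_1 ≤ r`. -/
def multiIndices (d r : ℕ) : Finset (Fin d → ℕ) :=
  (Fintype.piFinset fun _ => Finset.range (r + 1)).filter fun α => ∑ i, α i ≤ r

theorem mem_multiIndices {d r : ℕ} {α : Fin d → ℕ} :
    α ∈ multiIndices d r ↔ ∑ i, α i ≤ r := by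
  simp only [multiIndices, Finset.mem_filter, Fintype.mem_piFinset, Finset.mem_range,
    and_iff_right_iff_imp]
  intro h i
  have := Finset.single_le_sum (f := α) (fun _ _ => Nat.zero_le _) (Finset.mem_univ i)
  omega

/-- `g` is a weak derivative `D^α f` on the open set `U`. -/
def IsWeakDeriv {d : ℕ} (U : Set (Fin d → ℝ)) (α : Fin d → ℕ) (f g : (Fin d → ℝ) → ℝ) : Prop :=
  LocallyIntegrableOn f U ∧ LocallyIntegrableOn g U ∧
    ∀ φ : (Fin d → ℝ) → ℝ, ContDiff ℝ (⊤ : ℕ∞) φ → HasCompactSupport φ → tsupport φ ⊆ U →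
      ∫ x in U, f x * multiD α φ x = (-1) ^ (∑ i, α i) * ∫ x in U, g x * φ x

/-- `g` lists the derivatives of `f` up to order `r`: `g 0 = f`, and for `0 < |α|_1 ≤ r` the
function `g α` is a weak derivative `D^α f` on the interior of `G`. -/
def IsWeakDerivFamily {d : ℕ} (r : ℕ) (G : Set (Fin d → ℝ)) (f : (Fin d → ℝ) → ℝ)
    (g : (Fin d → ℕ) → (Fin d → ℝ) → ℝ) : Prop :=
  g 0 = f ∧ ∀ α ∈ multiIndices d r, α ≠ 0 → IsWeakDeriv (interior G) α f (g α)

/-- `(∑_{a ∈ s} v_a ^ p)^{1/p}` for `p < ∞`, and `max_{a ∈ s} v_a` for `p = ∞`. -/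
noncomputable def lpSum {ι : Type*} (p : ℝ≥0∞) (s : Finset ι) (v : ι → ℝ≥0∞) : ℝ≥0∞ :=
  if p = ⊤ then s.sup v else (∑ a ∈ s, v a ^ p.toReal) ^ (1 / p.toReal)

/-- The norm `‖f‖_{W_p^r(G)} = (∑_{|α|_1 ≤ r} ‖D^α f‖_{L_p}^p)^{1/p}` (a maximum for `p = ∞`),
with value `∞` if some weak derivative does not exist. Weak derivatives are unique up to null sets,
so that the infimum runs over one value at most. The set `G` need not be open: `f` itself is
measured on `G`, and the derivatives of positive order, which test functions determine on the
interior only, are measured there. -/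
noncomputable def sobolevNorm {d : ℕ} (r : ℕ) (p : ℝ≥0∞) (G : Set (Fin d → ℝ))
    (f : (Fin d → ℝ) → ℝ) : ℝ≥0∞ :=
  ⨅ (g : (Fin d → ℕ) → (Fin d → ℝ) → ℝ) (_ : IsWeakDerivFamily r G f g),
    lpSum p (multiIndices d r) fun α =>
      eLpNorm (g α) p (volume.restrict (if α = 0 then G else interior G))

/-- The functions of `W_p^r(G)` whose integral over `G` exists (all of them if `G` has finite
measure, or if `p = 1`). The elements are functions, not classes, since they are to be evaluated at
points; only the values on `G` matter. -/
def sobolevSpace {d : ℕ} (r : ℕ) (p : ℝ≥0∞) (G : Set (Fin d → ℝ)) : Set ((Fin d → ℝ) → ℝ) :=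
  {f | MemLp f p (volume.restrict G) ∧ sobolevNorm r p G f < ⊤ ∧ IntegrableOn f G}

/-- The functions of `W_p^r(G)` that are continuous on `G`. -/
def continuousSobolevSpace {d : ℕ} (r : ℕ) (p : ℝ≥0∞) (G : Set (Fin d → ℝ)) :
    Set ((Fin d → ℝ) → ℝ) :=
  {f | f ∈ sobolevSpace r p G ∧ ContinuousOn f G}

/-! ### Randomized algorithms and the probabilistic error -/

/-- A randomized, possibly adaptive algorithm that uses `n` function values at points of `G`. For
the random element `ω`, after `k` values `y_1, …, y_k` have been observed, the next one is taken at
`node ω k (y_1, …, y_k)`; from the `n` values the result is computed by `output ω`. The algorithm is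
non-adaptive if `node ω k` is constant for all `ω` and `k`. -/
structure MCAlgorithm {d : ℕ} (G : Set (Fin d → ℝ)) (n : ℕ) (Ω : Type*) where
  node : Ω → (k : ℕ) → (Fin k → ℝ) → G
  output : Ω → (Fin n → ℝ) → ℝ

namespace MCAlgorithm

/-- The first `k` observed values. -/
def info {d : ℕ} {G : Set (Fin d → ℝ)} {n : ℕ} {Ω : Type*} (A : MCAlgorithm G n Ω) (ω : Ω)
    (f : (Fin d → ℝ) → ℝ) : (k : ℕ) → Fin k → ℝ
  | 0 => Fin.elim0
  | k + 1 => Fin.snoc (α := fun _ => ℝ) (A.info ω f k) (f (A.node ω k (A.info ω f k)))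

/-- The result `A^ω(f)`. -/
def run {d : ℕ} {G : Set (Fin d → ℝ)} {n : ℕ} {Ω : Type*} (A : MCAlgorithm G n Ω) (ω : Ω)
    (f : (Fin d → ℝ) → ℝ) : ℝ :=
  A.output ω (A.info ω f n)

/-- `|A^ω(f) - ∫_G f|`. -/
noncomputable def error {d : ℕ} {G : Set (Fin d → ℝ)} {n : ℕ} {Ω : Type*} (A : MCAlgorithm G n Ω)
    (f : (Fin d → ℝ) → ℝ) (ω : Ω) : ℝ :=
  |A.run ω f - ∫ x in G, f x|

/-- `A` is an algorithm on the space `𝓦` (its error is measurable for every input) which is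
`(ε, δ)`-approximating for the inputs of norm at most one. -/
def IsApproximating {d : ℕ} {G : Set (Fin d → ℝ)} {n : ℕ} {Ω : Type*} [MeasurableSpace Ω]
    (A : MCAlgorithm G n Ω) (P : Measure Ω) (𝓦 : Set ((Fin d → ℝ) → ℝ))
    (norm : ((Fin d → ℝ) → ℝ) → ℝ≥0∞) (ε δ : ℝ) : Prop :=
  (∀ f ∈ 𝓦, Measurable (A.error f)) ∧
    ∀ f ∈ 𝓦, norm f ≤ 1 → P {ω | ε < A.error f ω} ≤ ENNReal.ofReal δ

end MCAlgorithm

/-- The `n`-th minimal probabilistic Monte Carlo error at uncertainty `δ` for integration over `G`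
of functions from the unit ball of `𝓦`: the infimum of all `ε > 0` for which there is an
`(ε, δ)`-approximating algorithm with `n` function values (`∞` if there is none). -/
noncomputable def probError {d : ℕ} (G : Set (Fin d → ℝ)) (n : ℕ) (δ : ℝ)
    (𝓦 : Set ((Fin d → ℝ) → ℝ)) (norm : ((Fin d → ℝ) → ℝ) → ℝ≥0∞) : ℝ≥0∞ :=
  sInf {e : ℝ≥0∞ | ∃ ε : ℝ, 0 < ε ∧ e = ENNReal.ofReal ε ∧
    ∃ (Ω : Type u) (_ : MeasurableSpace Ω) (P : Measure Ω) (_ : IsProbabilityMeasure P)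
      (A : MCAlgorithm G n Ω), A.IsApproximating P 𝓦 norm ε δ}

/-- `min {n^{-r/d}, n^{-(r/d + 1 - 1/q)} (log δ⁻¹)^{1 - 1/q}}` with `q = min {p, 2}`. -/
noncomputable def lowerRate (d r : ℕ) (p : ℝ≥0∞) (n : ℕ) (δ : ℝ) : ℝ :=
  let q : ℝ := (min p 2).toReal
  min ((n : ℝ) ^ (-((r : ℝ) / d)))
    ((n : ℝ) ^ (-((r : ℝ) / d + 1 - 1 / q)) * Real.log δ⁻¹ ^ (1 - 1 / q))

/-! The proof averages over a finite family of hard inputs. Fit `2n` disjoint bumps into the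
interior of `G` and let the inputs be combinations whose coefficients `1`, `-1`, `0` are read off a
uniformly random word (`exists_bump_system`). For fixed `ω` an algorithm with `n` values sees at
most `n` letters (`MCAlgorithm.exists_observed`), and the unseen letters may be resampled without
its noticing. Their sum is symmetric, so whatever the output, one of its two tails makes the
algorithm miss the integral (`decisionTree_card_error_ge`). If the unseen sum reaches `t` with
probability `β`, the error is at least a multiple of `t` on a proportion `β/2` of the words, the
factor `1/2` being the price for keeping the norm under control. Averaging over `ω` then excludes
every `δ < β/2` (`le_of_forall_measure_le`, `le_probError_of_tail`).

It remains to bound tails from below by `exp (-6k)`, where `k` is of order `log δ⁻¹`, capped at `n`.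
For `p ≥ 2` all coefficients are signs and the sum reaches order `√(nk)` (`dense_tail`). For `p < 2`
it is better to have only about `k` nonzero coefficients: the support is small, so the `L_p`
normalization allows bumps higher by a factor of order `(n/k)^{1/p}`, and the sum reaches `k`
(`sparse_tail`, `half_card_le_card_sparse`). One bump has integral of order `n^{-r/d-1}`, so both
cases give `n^{-r/d} (k/n)^{1-1/q}`; the cap `k = n` produces the term `n^{-r/d}` of the minimum. -/

/-! ### Resampling the unobserved coordinates of a decision tree -/

/-- The word that agrees with `s` on `I` and with `u` off `I`. -/
def mixOn {ι α : Type*} [DecidableEq ι] (I : Finset ι) (s u : ι → α) : ι → α :=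
  fun i => if i ∈ I then s i else u i

theorem mixOn_mixOn {ι α : Type*} [DecidableEq ι] (I : Finset ι) (s u : ι → α) :
    mixOn I (mixOn I s u) (mixOn I u s) = s := by
  funext i
  by_cases h : i ∈ I <;> simp [mixOn, h]

/-- If `I s` depends on the values of `s` on `I s` only, then exchanging the coordinates off `I s`
of `s` and `u` is an involution on pairs of words. -/
def swapOff {ι α : Type*} [DecidableEq ι] (I : (ι → α) → Finset ι)
    (hI : ∀ s s', (∀ i ∈ I s, s' i = s i) → I s' = I s) : Equiv.Perm ((ι → α) × (ι → α)) :=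
  Function.Involutive.toPerm (fun q => (mixOn (I q.1) q.1 q.2, mixOn (I q.1) q.2 q.1)) (by
    rintro ⟨s, u⟩
    have h : I (mixOn (I s) s u) = I s := hI _ _ fun i hi => by simp [mixOn, hi]
    simp only [h, mixOn_mixOn])

/-- A uniform word whose letters off `I s` are redrawn is again uniform, because `swapOff` permutes
the pairs of words. Conditional probabilities given the observed letters thus become plain counts.
-/
theorem card_mul_le_of_resample {ι α : Type*} [DecidableEq ι] [Fintype ι] [Fintype α]
    (I : (ι → α) → Finset ι) (hI : ∀ s s', (∀ i ∈ I s, s' i = s i) → I s' = I s)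
    (Q : (ι → α) → Prop) [DecidablePred Q] (H : Finset (ι → α)) (b : ℝ)
    (h : ∀ s ∈ H, b ≤ (Finset.univ.filter fun u => Q (mixOn (I s) s u)).card) :
    H.card * b ≤ (Finset.univ.filter Q).card * (Fintype.card (ι → α) : ℝ) := by
  classical
  have key : ∑ q : (ι → α) × (ι → α), (if Q (mixOn (I q.1) q.1 q.2) then (1 : ℝ) else 0)
      = ∑ q : (ι → α) × (ι → α), (if Q q.1 then (1 : ℝ) else 0) :=
    Equiv.sum_comp (swapOff I hI) fun q => if Q q.1 then (1 : ℝ) else 0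
  rw [Fintype.sum_prod_type, Fintype.sum_prod_type] at key
  have hr : ∑ s : ι → α, ∑ _u : ι → α, (if Q s then (1 : ℝ) else 0)
      = (Finset.univ.filter Q).card * (Fintype.card (ι → α) : ℝ) := by
    simp only [Finset.sum_const, Finset.card_univ, nsmul_eq_mul, ← Finset.mul_sum,
      Finset.sum_boole]
    rw [mul_comm]
  rw [← hr, ← key]
  calc H.card * b = ∑ _s ∈ H, b := by simp
    _ ≤ ∑ s ∈ H, ∑ u : ι → α, (if Q (mixOn (I s) s u) then (1 : ℝ) else 0) := by
        refine Finset.sum_le_sum fun s hs => ?_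
        simpa [Finset.sum_boole] using h s hs
    _ ≤ _ := by
        refine Finset.sum_le_sum_of_subset_of_nonneg (Finset.subset_univ _) fun s _ _ => ?_
        exact Finset.sum_nonneg fun u _ => by split_ifs <;> norm_num

/-- A decision tree that observes at most `n` letters of a random word `s` has a large error for
`∑ i, v (s i)` with a probability that is controlled by the tail of the unobserved part. -/
theorem decisionTree_card_error_ge {ι α : Type*} [DecidableEq ι] [Fintype ι] [Fintype α]
    (v : α → ℝ) (neg : Equiv.Perm α) (hneg : ∀ a, v (neg a) = -v a)
    (n : ℕ) (I : (ι → α) → Finset ι) (out : (ι → α) → ℝ)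
    (hI : ∀ s s', (∀ i ∈ I s, s' i = s i) → I s' = I s ∧ out s' = out s)
    (hcard : ∀ s, (I s).card ≤ n) (t w β : ℝ) (hβ : 0 ≤ β)
    (hH : (Fintype.card (ι → α) : ℝ) / 2 ≤
      (Finset.univ.filter fun s : ι → α => ∑ i, |v (s i)| ≤ w).card)
    (htail : ∀ F : Finset ι, Fintype.card ι ≤ F.card + n → β * Fintype.card (ι → α) ≤
      (Finset.univ.filter fun u : ι → α => t ≤ ∑ i ∈ F, v (u i) ∧ ∑ i ∈ F, |v (u i)| ≤ w).card) :
    β / 2 * Fintype.card (ι → α) ≤ (Finset.univ.filter fun s : ι → α =>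
      t ≤ |out s - ∑ i, v (s i)| ∧ ∑ i, |v (s i)| ≤ 2 * w).card := by
  classical
  rcases isEmpty_or_nonempty (ι → α) with he | hne
  · simp
  have hpos : (0 : ℝ) < Fintype.card (ι → α) := by exact_mod_cast Fintype.card_pos
  -- Reversing all signs turns the upper tail into the lower tail.
  have htail' : ∀ F : Finset ι, Fintype.card ι ≤ F.card + n → β * Fintype.card (ι → α) ≤
      (Finset.univ.filter fun u : ι → α =>
        t ≤ -∑ i ∈ F, v (u i) ∧ ∑ i ∈ F, |v (u i)| ≤ w).card := by
    intro F hF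
    refine (htail F hF).trans_eq ?_
    norm_cast
    refine Finset.card_equiv (Equiv.arrowCongr (Equiv.refl ι) neg) fun u => ?_
    simp [Equiv.arrowCongr, hneg]
  have hsplit : ∀ (g : α → ℝ) (s u : ι → α), ∑ i, g (mixOn (I s) s u i)
      = ∑ i ∈ I s, g (s i) + ∑ i ∈ (I s)ᶜ, g (u i) := by
    intro g s u
    rw [← Finset.sum_add_sum_compl (I s)]
    congr 1 <;> refine Finset.sum_congr rfl fun i hi => ?_
    · simp [mixOn, hi]
    · rw [Finset.mem_compl] at hi
      simp [mixOn, hi]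
  have := card_mul_le_of_resample I (fun s s' h => (hI s s' h).1)
    (fun s => t ≤ |out s - ∑ i, v (s i)| ∧ ∑ i, |v (s i)| ≤ 2 * w)
    (Finset.univ.filter fun s : ι → α => ∑ i, |v (s i)| ≤ w) (β * Fintype.card (ι → α)) ?_
  -- At least half of the words lie in `H`, and each contributes a proportion `β` of resamplings.
  · have h2 := mul_le_mul_of_nonneg_right hH (mul_nonneg hβ hpos.le)
    refine le_of_mul_le_mul_right ?_ hpos
    calc _ = (Fintype.card (ι → α) : ℝ) / 2 * (β * Fintype.card (ι → α)) := by ring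
      _ ≤ _ := h2.trans this
  · intro s hs
    have hs' : ∑ i, |v (s i)| ≤ w := by simpa using hs
    have hF : Fintype.card ι ≤ ((I s)ᶜ).card + n := by
      have := hcard s
      have := Finset.card_compl_add_card (I s)
      omega
    have hIw : ∑ i ∈ I s, |v (s i)| ≤ w :=
      (Finset.sum_le_sum_of_subset_of_nonneg (Finset.subset_univ _)
        fun _ _ _ => abs_nonneg _).trans hs'
    have hout : ∀ u, out (mixOn (I s) s u) = out s := fun u =>
      (hI _ _ fun i hi => by simp [mixOn, hi]).2
    -- The output is unchanged by resampling. If it lies below the observed sum, an upper tail of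
    -- the rest increases the gap to at least `t`; otherwise a lower tail does. Observed and
    -- resampled letters contribute at most `w` each, whence `2 * w`.
    rcases le_total (out s) (∑ i ∈ I s, v (s i)) with hle | hle
    · refine (htail _ hF).trans ?_
      norm_cast
      refine Finset.card_le_card fun u => ?_
      simp only [Finset.mem_filter, Finset.mem_univ, true_and, hsplit, hout,
        hsplit (fun a => |v a|)]
      rintro ⟨h1, h2⟩
      refine ⟨?_, by linarith⟩
      rw [abs_sub_comm]
      exact le_trans (by linarith) (le_abs_self _)
    · refine (htail' _ hF).trans ?_
      norm_cast
      refine Finset.card_le_card fun u => ?_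
      simp only [Finset.mem_filter, Finset.mem_univ, true_and, hsplit, hout,
        hsplit (fun a => |v a|)]
      rintro ⟨h1, h2⟩
      refine ⟨?_, by linarith⟩
      exact le_trans (by linarith) (le_abs_self _)

/-! ### Tails of sums of random signs, dense and sparse -/

/-- The letter `(0, ±)` stands for `±1`, every other letter for `0`. -/
def signedValue {M : ℕ} (a : Fin (M + 1) × Bool) : ℝ :=
  if a.1 = 0 then (if a.2 then 1 else -1) else 0

/-- Reversal of the sign. -/
def flipSign (M : ℕ) : Equiv.Perm (Fin (M + 1) × Bool) :=
  Equiv.prodCongr (Equiv.refl _) Equiv.boolNot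

theorem signedValue_flipSign {M : ℕ} (a : Fin (M + 1) × Bool) :
    signedValue (flipSign M a) = -signedValue a := by
  rcases a with ⟨i, b⟩
  cases b <;> by_cases h : i = 0 <;> simp [signedValue, flipSign, h, Equiv.boolNot]

theorem abs_signedValue {M : ℕ} (a : Fin (M + 1) × Bool) :
    |signedValue a| = if a.1 = 0 then 1 else 0 := by
  rcases a with ⟨i, b⟩
  cases b <;> by_cases h : i = 0 <;> simp [signedValue, h]

theorem abs_signedValue_le_one {M : ℕ} (a : Fin (M + 1) × Bool) : |signedValue a| ≤ 1 := by
  rw [abs_signedValue]; split_ifs <;> norm_num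

/-! ### Moments and tails of the simple random walk. -/

/-- The mean of `g` at the position of the simple random walk after `m` steps. -/
noncomputable def walkMean : ℕ → (ℝ → ℝ) → ℝ
  | 0, g => g 0
  | m + 1, g => (walkMean m (fun x => g (x + 1)) + walkMean m (fun x => g (x - 1))) / 2

theorem walkMean_mono {m : ℕ} {g h : ℝ → ℝ} (hgh : ∀ x, g x ≤ h x) :
    walkMean m g ≤ walkMean m h := by
  induction m generalizing g h with
  | zero => exact hgh 0
  | succ m ih =>
    have h1 := ih (g := fun x => g (x + 1)) (h := fun x => h (x + 1)) fun x => hgh _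
    have h2 := ih (g := fun x => g (x - 1)) (h := fun x => h (x - 1)) fun x => hgh _
    simp only [walkMean]
    linarith

theorem walkMean_add (m : ℕ) (g h : ℝ → ℝ) :
    walkMean m (fun x => g x + h x) = walkMean m g + walkMean m h := by
  induction m generalizing g h with
  | zero => rfl
  | succ m ih => simp only [walkMean, ih]; ring

theorem walkMean_const_mul (m : ℕ) (c : ℝ) (g : ℝ → ℝ) :
    walkMean m (fun x => c * g x) = c * walkMean m g := by
  induction m generalizing g with
  | zero => rfl
  | succ m ih => simp only [walkMean, ih]; ring

theorem walkMean_const (m : ℕ) (c : ℝ) : walkMean m (fun _ => c) = c := by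
  induction m with
  | zero => rfl
  | succ m ih => simp only [walkMean, ih]; ring

theorem walkMean_neg (m : ℕ) (g : ℝ → ℝ) : walkMean m (fun x => g (-x)) = walkMean m g := by
  induction m generalizing g with
  | zero => simp [walkMean]
  | succ m ih =>
    have h1 := ih fun x => g (x - 1)
    have h2 := ih fun x => g (x + 1)
    simp only [walkMean, ← h1, ← h2]
    rw [add_comm]
    congr 3 <;> funext x <;> congr 1 <;> ring

/-- Independence of the first `m` and the last `k` steps. -/
theorem walkMean_add_steps (m k : ℕ) (g : ℝ → ℝ) :
    walkMean (m + k) g = walkMean m fun x => walkMean k fun y => g (x + y) := by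
  induction k generalizing g with
  | zero => simp [walkMean]
  | succ k ih =>
    rw [← add_assoc, walkMean, ih, ih]
    have := walkMean_const_mul m (1 / 2) fun x =>
      walkMean k (fun y => g (x + (y + 1))) + walkMean k (fun y => g (x + (y - 1)))
    rw [walkMean_add] at this
    simp only [walkMean, add_assoc, add_sub_assoc]
    convert this.symm using 1
    · ring
    · congr 1; funext x; ring

theorem walkMean_sq (m : ℕ) : walkMean m (fun x => x ^ 2) = m := by
  have h : ∀ (m : ℕ) (a : ℝ), walkMean m (fun x => (x + a) ^ 2) = m + a ^ 2 := by
    intro m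
    induction m with
    | zero => intro a; simp [walkMean]
    | succ m ih =>
      intro a
      have h1 := ih (1 + a)
      have h2 := ih (-1 + a)
      simp only [walkMean, sub_eq_add_neg, add_assoc, h1, h2]
      push_cast; ring
  simpa using h m 0

theorem walkMean_pow_four (m : ℕ) : walkMean m (fun x => x ^ 4) ≤ 3 * (m : ℝ) ^ 2 := by
  have h : ∀ (m : ℕ) (a : ℝ), walkMean m (fun x => (x + a) ^ 4)
      = 3 * (m : ℝ) ^ 2 - 2 * m + 6 * m * a ^ 2 + a ^ 4 := by
    intro m
    induction m with
    | zero => intro a; simp [walkMean]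
    | succ m ih =>
      intro a
      have h1 := ih (1 + a)
      have h2 := ih (-1 + a)
      simp only [walkMean, sub_eq_add_neg, add_assoc, h1, h2]
      push_cast; ring
  have := h m 0
  simp only [add_zero] at this
  rw [this]
  have : (0 : ℝ) ≤ m := Nat.cast_nonneg m
  linarith

/-- The probability that the simple random walk is at `t` or above after `m` steps. -/
noncomputable def walkTail (m : ℕ) (t : ℝ) : ℝ := walkMean m fun x => if t ≤ x then 1 else 0

theorem walkMean_indicator_nonneg (m : ℕ) (Q : ℝ → Prop) [DecidablePred Q] :
    0 ≤ walkMean m fun x => if Q x then 1 else 0 :=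
  (walkMean_const m 0).symm.trans_le <| walkMean_mono fun x => by split_ifs <;> norm_num

theorem walkTail_nonneg (m : ℕ) (t : ℝ) : 0 ≤ walkTail m t :=
  walkMean_indicator_nonneg m fun x => t ≤ x

theorem walkTail_mul_le (m k : ℕ) (s t : ℝ) :
    walkTail m s * walkTail k t ≤ walkTail (m + k) (s + t) := by
  rw [walkTail, walkTail, walkTail, walkMean_add_steps, mul_comm, ← walkMean_const_mul]
  refine walkMean_mono fun x => ?_
  by_cases hx : s ≤ x
  · simp only [hx, if_true, mul_one]
    refine walkMean_mono fun y => ?_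
    by_cases hy : t ≤ y
    · simp [hy, add_le_add hx hy]
    · simp only [hy, if_false]; split_ifs <;> norm_num
  · simp only [hx, if_false, mul_zero]
    exact walkMean_indicator_nonneg k fun y => s + t ≤ x + y

theorem half_le_walkTail_zero (m : ℕ) : 1 / 2 ≤ walkTail m 0 := by
  have h1 : walkTail m 0 = walkMean m fun x => if 0 ≤ -x then 1 else 0 :=
    (walkMean_neg m fun x => if 0 ≤ x then 1 else 0).symm
  have h2 : walkMean m (fun _ => 1) ≤ walkMean m fun x =>
      (if 0 ≤ x then 1 else 0) + (if 0 ≤ -x then 1 else 0) := by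
    refine walkMean_mono fun x => ?_
    rcases le_total 0 x with h | h
    · simp only [h, if_true]; split_ifs <;> norm_num
    · simp only [neg_nonneg, h, if_true]; split_ifs <;> norm_num
  rw [walkMean_const, walkMean_add, ← h1, ← walkTail] at h2
  linarith

/-- Second and fourth moments suffice. The quartic in the proof attains its maximum `729/64 m²` at
`x² = 29/8 m`, and its mean is at least `(29/4 - 3 - 7/4) m² = 5/2 m²`. By symmetry each tail has
probability at least `80/729 > 1/10`. -/
theorem tenth_le_walkTail_sqrt (m : ℕ) (hm : 0 < m) : 1 / 10 ≤ walkTail m (√m / 2) := by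
  have hm' : (0 : ℝ) < m := by exact_mod_cast hm
  have h1 : walkTail m (√m / 2) = walkMean m fun x => if √m / 2 ≤ -x then 1 else 0 :=
    (walkMean_neg m fun x => if √m / 2 ≤ x then 1 else 0).symm
  have hs : (√(m : ℝ)) ^ 2 = m := Real.sq_sqrt hm'.le
  have hs0 : 0 < √(m : ℝ) := Real.sqrt_pos.2 hm'
  -- the polynomial `(x² - m/4) (7 m - x²)` is below a multiple of the indicator of `|x| ≥ √m/2`
  have h2 : walkMean m (fun x => (29 / 4 * m) * x ^ 2 + ((-1) * x ^ 4 + (-(7 / 4) * (m : ℝ) ^ 2)))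
      ≤ walkMean m fun x => (729 / 64 * (m : ℝ) ^ 2) *
        ((if √m / 2 ≤ x then 1 else 0) + (if √m / 2 ≤ -x then 1 else 0)) := by
    refine walkMean_mono fun x => ?_
    by_cases hx : √m / 2 ≤ x ∨ √m / 2 ≤ -x
    · have : (1 : ℝ) ≤ (if √m / 2 ≤ x then 1 else 0) + (if √m / 2 ≤ -x then 1 else 0) := by
        rcases hx with hx | hx <;> simp only [hx, if_true] <;> split_ifs <;> norm_num
      nlinarith [sq_nonneg (x ^ 2 - 29 / 8 * m), sq_nonneg (m : ℝ)]
    · push Not at hx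
      have hx2 : x ^ 2 ≤ m / 4 := by nlinarith [hx.1, hx.2]
      simp only [not_le.2 hx.1, not_le.2 hx.2, if_false]
      nlinarith
  rw [walkMean_add, walkMean_add, walkMean_const_mul, walkMean_const_mul, walkMean_const,
    walkMean_const_mul, walkMean_add, ← h1, ← walkTail, walkMean_sq] at h2
  have h4 := walkMean_pow_four m
  have h5 : (5 / 2 : ℝ) * (m : ℝ) ^ 2 ≤ 729 / 32 * walkTail m (√m / 2) * (m : ℝ) ^ 2 := by
    nlinarith
  have := le_of_mul_le_mul_right h5 (by positivity)
  linarith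

/-- It suffices that each of `k` independent blocks of length `m` climbs `√m / 2` and that the `l`
remaining steps do not end below zero. This reaches deviations far beyond the standard one at
exponential cost in `k`. -/
theorem walkTail_blocks (m : ℕ) (hm : 0 < m) (k l : ℕ) :
    (1 / 10) ^ k * (1 / 2) ≤ walkTail (l + k * m) (k * (√m / 2)) := by
  induction k with
  | zero => simpa using half_le_walkTail_zero l
  | succ k ih =>
    have h := walkTail_mul_le (l + k * m) m (k * (√m / 2)) (√m / 2)
    have h1 := mul_le_mul ih (tenth_le_walkTail_sqrt m hm) (by norm_num) (walkTail_nonneg _ _)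
    have e1 : l + (k + 1) * m = l + k * m + m := by ring
    have e2 : ((k + 1 : ℕ) : ℝ) * (√m / 2) = k * (√m / 2) + √m / 2 := by push_cast; ring
    rw [e1, e2]
    refine le_trans (le_of_eq ?_) (h1.trans h)
    ring

theorem sum_signs_eq_walkMean {ι : Type*} [DecidableEq ι] [Fintype ι] (F : Finset ι)
    (g : ℝ → ℝ) :
    ∑ u : ι → Fin (0 + 1) × Bool, g (∑ i ∈ F, signedValue (u i))
      = Fintype.card (ι → Fin (0 + 1) × Bool) * walkMean F.card g := by
  classical
  induction F using Finset.induction_on generalizing g with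
  | empty => simp [walkMean]
  | insert j F hj ih =>
    -- Flipping the sign at `j` pairs the words; each pair contributes one step up and one step
    -- down.
    let e : Equiv.Perm (ι → Fin (0 + 1) × Bool) :=
      Function.Involutive.toPerm (fun u => Function.update u j (flipSign 0 (u j))) (by
        intro u
        funext i
        by_cases h : i = j
        · subst h; rcases hu : u i with ⟨a, b⟩; simp [flipSign, Equiv.boolNot, hu]
        · simp [h])
    have he : ∀ u, e u = Function.update u j (flipSign 0 (u j)) := fun u => rfl
    have hF : ∀ u, ∑ i ∈ F, signedValue (e u i) = ∑ i ∈ F, signedValue (u i) := by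
      intro u
      refine Finset.sum_congr rfl fun i hi => ?_
      have : i ≠ j := fun h => hj (h ▸ hi)
      simp [he, this]
    have hej : ∀ u, signedValue (e u j) = -signedValue (u j) := by
      intro u; simp [he, signedValue_flipSign]
    have h1 : ∑ u : ι → Fin (0 + 1) × Bool, g (∑ i ∈ insert j F, signedValue (u i))
        = ∑ u : ι → Fin (0 + 1) × Bool,
          g (∑ i ∈ F, signedValue (u i) - signedValue (u j)) := by
      rw [← Equiv.sum_comp e]
      refine Finset.sum_congr rfl fun u _ => ?_
      rw [Finset.sum_insert hj, hF, hej]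
      congr 1; ring
    have h2 : ∑ u : ι → Fin (0 + 1) × Bool, g (∑ i ∈ insert j F, signedValue (u i))
        + ∑ u : ι → Fin (0 + 1) × Bool, g (∑ i ∈ insert j F, signedValue (u i))
        = ∑ u : ι → Fin (0 + 1) × Bool, g (∑ i ∈ F, signedValue (u i) + 1)
        + ∑ u : ι → Fin (0 + 1) × Bool, g (∑ i ∈ F, signedValue (u i) - 1) := by
      nth_rewrite 2 [h1]
      rw [← Finset.sum_add_distrib, ← Finset.sum_add_distrib]
      refine Finset.sum_congr rfl fun u _ => ?_
      rw [Finset.sum_insert hj]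
      rcases hb : u j with ⟨i, b⟩
      have hi : i = 0 := Subsingleton.elim (α := Fin 1) _ _
      cases b <;> simp [signedValue, hi, add_comm, ← sub_eq_neg_add]
    rw [ih fun x => g (x + 1), ih fun x => g (x - 1)] at h2
    rw [Finset.card_insert_of_notMem hj, walkMean]
    linarith

/-- Dense signs: the tail at the level `√(n k)`. -/
theorem dense_tail {ι : Type*} [DecidableEq ι] [Fintype ι] {n k : ℕ} (hk : 1 ≤ k) (hkn : k ≤ n)
    (F : Finset ι) (hF : n ≤ F.card) :
    Real.exp (-(6 * k)) * Fintype.card (ι → Fin (0 + 1) × Bool) ≤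
      (Finset.univ.filter fun u : ι → Fin (0 + 1) × Bool =>
        √(n * k) / 3 ≤ ∑ i ∈ F, signedValue (u i)).card := by
  classical
  have hm : 0 < n / k := Nat.div_pos hkn hk
  have hk0 : (0 : ℝ) < k := by exact_mod_cast hk
  have hle : n / k * k ≤ n := Nat.div_mul_le_self n k
  obtain ⟨l, hl⟩ : ∃ l, F.card = l + k * (n / k) :=
    ⟨F.card - k * (n / k), by rw [mul_comm k]; omega⟩
  have h1 := walkTail_blocks (n / k) hm k l
  rw [← hl] at h1
  -- Rounding the block length `n / k` down loses at most a factor `2`, hence at most `√2 ≤ 3/2` in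
  -- the level: this turns the `1/2` of `walkTail_blocks` into `1/3`.
  have hB : (n : ℝ) ≤ 2 * k * (n / k : ℕ) := by
    have h3 : n < n / k * k + k := Nat.lt_div_mul_add hk
    have h4 : k ≤ n / k * k := Nat.le_mul_of_pos_left k hm
    have : n ≤ 2 * k * (n / k) := by nlinarith
    exact_mod_cast this
  have ht : √(n * k) / 3 ≤ k * (√((n / k : ℕ) : ℝ) / 2) := by
    have : √((n : ℝ) * k) ≤ 3 / 2 * k * √((n / k : ℕ) : ℝ) := by
      rw [Real.sqrt_le_left (by positivity), mul_pow, Real.sq_sqrt (Nat.cast_nonneg _)]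
      nlinarith [mul_pos hk0 hk0, mul_le_mul_of_nonneg_right hB hk0.le,
        (Nat.cast_nonneg (n / k) : (0 : ℝ) ≤ ((n / k : ℕ) : ℝ)),
        mul_nonneg (mul_pos hk0 hk0).le (Nat.cast_nonneg (n / k) : (0 : ℝ) ≤ ((n / k : ℕ) : ℝ))]
    linarith
  have hexp : Real.exp (-(6 * k)) ≤ (1 / 10 : ℝ) ^ k * (1 / 2) := by
    have h3 : (20 : ℝ) ≤ Real.exp 6 := by
      have := Real.add_one_le_exp (2 : ℝ)
      have h6 : Real.exp 6 = Real.exp 2 ^ 3 := by rw [← Real.exp_nat_mul]; norm_num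
      rw [h6]
      calc (20 : ℝ) ≤ (2 + 1) ^ 3 := by norm_num
        _ ≤ _ := pow_le_pow_left₀ (by norm_num) this 3
    have h4 : (20 : ℝ) ^ k ≤ Real.exp (6 * k) := by
      rw [mul_comm, Real.exp_nat_mul]
      exact pow_le_pow_left₀ (by norm_num) h3 k
    have h5 : (2 : ℝ) ≤ 2 ^ k := by
      simpa using pow_le_pow_right₀ (by norm_num : (1 : ℝ) ≤ 2) hk
    have h6 : (20 : ℝ) ^ k = 2 ^ k * 10 ^ k := by rw [← mul_pow]; norm_num
    rw [Real.exp_neg, one_div, inv_pow, one_div, ← mul_inv]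
    refine inv_anti₀ (by positivity) ?_
    nlinarith [pow_pos (by norm_num : (0 : ℝ) < 10) k]
  have hmono : walkTail F.card (k * (√((n / k : ℕ) : ℝ) / 2)) ≤ walkTail F.card (√(n * k) / 3) := by
    refine walkMean_mono fun x => ?_
    by_cases hx : k * (√((n / k : ℕ) : ℝ) / 2) ≤ x
    · rw [if_pos hx, if_pos (ht.trans hx)]
    · simp only [hx, if_false]; split_ifs <;> norm_num
  have hsum := sum_signs_eq_walkMean F fun x => if √(n * k) / 3 ≤ x then 1 else 0
  rw [Finset.sum_boole, ← walkTail] at hsum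
  rw [hsum, mul_comm]
  exact mul_le_mul_of_nonneg_left (hexp.trans (h1.trans hmono)) (Nat.cast_nonneg _)

/-! ### Counting words with few nonzero letters. -/

theorem div_pow_le_choose {k f : ℕ} (h : k ≤ f) : ((f : ℝ) / k) ^ k ≤ f.choose k := by
  induction k generalizing f with
  | zero => simp
  | succ k ih =>
    obtain ⟨f, rfl⟩ : ∃ f', f = f' + 1 := ⟨f - 1, by omega⟩
    have hkf : k ≤ f := by omega
    have hc : ((f + 1 : ℕ) : ℝ) * f.choose k = (f + 1).choose (k + 1) * ((k + 1 : ℕ) : ℝ) := by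
      exact_mod_cast Nat.add_one_mul_choose_eq f k
    have hk0 : (0 : ℝ) < ((k + 1 : ℕ) : ℝ) := by positivity
    have hc' : ((f + 1).choose (k + 1) : ℝ) = ((f + 1 : ℕ) : ℝ) / ((k + 1 : ℕ) : ℝ) * f.choose k := by
      field_simp; linarith
    -- One factor `(f + 1) / (k + 1)` is split off; the others only grow, since `(f + 1) / (k + 1) ≤
    -- f / k` for `k ≤ f`.
    rw [hc', pow_succ']
    refine mul_le_mul_of_nonneg_left (le_trans ?_ (ih hkf)) (by positivity)
    rcases Nat.eq_zero_or_pos k with rfl | hk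
    · simp
    refine pow_le_pow_left₀ (by positivity) ?_ k
    have hk1 : (0 : ℝ) < k := by exact_mod_cast hk
    have hkf' : (k : ℝ) ≤ f := by exact_mod_cast hkf
    rw [div_le_div_iff₀ hk0 hk1]
    push_cast
    nlinarith

theorem card_fst_ne_zero (M : ℕ) :
    (Finset.univ.filter fun a : Fin (M + 1) × Bool => a.1 ≠ 0).card = 2 * M := by
  have : (Finset.univ.filter fun a : Fin (M + 1) × Bool => a.1 ≠ 0)
      = (Finset.univ.erase (0 : Fin (M + 1))) ×ˢ (Finset.univ : Finset Bool) := by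
    ext a; simp
  rw [this, Finset.card_product]
  simp [mul_comm]

theorem card_fst_eq_zero (M : ℕ) :
    (Finset.univ.filter fun a : Fin (M + 1) × Bool => a.1 = 0).card = 2 := by
  have : (Finset.univ.filter fun a : Fin (M + 1) × Bool => a.1 = 0)
      = ({0} : Finset (Fin (M + 1))) ×ˢ (Finset.univ : Finset Bool) := by
    ext ⟨i, b⟩; cases b <;> simp
  rw [this, Finset.card_product]
  simp

/-- The number of words with exactly `k` nonzero letters in `F`, all of them positive. -/
theorem choose_mul_le_card_positive {ι : Type*} [DecidableEq ι] [Fintype ι] (M k : ℕ)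
    (F : Finset ι) :
    F.card.choose k * ((2 * M) ^ (F.card - k) * (2 * (M + 1)) ^ (Fintype.card ι - F.card)) ≤
      (Finset.univ.filter fun u : ι → Fin (M + 1) × Bool =>
        ∑ i ∈ F, signedValue (u i) = k ∧ ∑ i ∈ F, |signedValue (u i)| = k).card := by
  classical
  -- `B K`: the letter `+1` on `K`, one of the `2 * M` spellings of zero on `F \ K`, anything off
  -- `F`. The word determines `K`, so these sets are disjoint.
  let B : Finset ι → Finset (ι → Fin (M + 1) × Bool) := fun K =>
    Fintype.piFinset fun i => if i ∈ K then {(0, true)} else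
      if i ∈ F then Finset.univ.filter fun a : Fin (M + 1) × Bool => a.1 ≠ 0 else Finset.univ
  have hB : ∀ {K u}, K ⊆ F → u ∈ B K → (∀ i ∈ K, u i = (0, true)) ∧
      ∀ i ∈ F, i ∉ K → (u i).1 ≠ 0 := by
    intro K u hK hu
    simp only [B, Fintype.mem_piFinset] at hu
    refine ⟨fun i hi => by simpa [hi] using hu i, fun i hi hi' => ?_⟩
    simpa [hi, hi'] using hu i
  have hcard : ∀ K ∈ F.powersetCard k, (B K).card =
      (2 * M) ^ (F.card - k) * (2 * (M + 1)) ^ (Fintype.card ι - F.card) := by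
    intro K hK
    obtain ⟨hKF, hKk⟩ := Finset.mem_powersetCard.1 hK
    rw [Fintype.card_piFinset, ← Finset.prod_mul_prod_compl F, ← Finset.prod_sdiff hKF]
    have h1 : ∀ i ∈ F \ K, (if i ∈ K then ({(0, true)} : Finset (Fin (M + 1) × Bool)) else
        if i ∈ F then Finset.univ.filter fun a : Fin (M + 1) × Bool => a.1 ≠ 0
        else Finset.univ).card = 2 * M := by
      intro i hi
      obtain ⟨h1, h2⟩ := Finset.mem_sdiff.1 hi
      rw [if_neg h2, if_pos h1, card_fst_ne_zero]
    have h2 : ∀ i ∈ K, (if i ∈ K then ({(0, true)} : Finset (Fin (M + 1) × Bool)) else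
        if i ∈ F then Finset.univ.filter fun a : Fin (M + 1) × Bool => a.1 ≠ 0
        else Finset.univ).card = 1 := by
      intro i hi
      rw [if_pos hi, Finset.card_singleton]
    have h3 : ∀ i ∈ Fᶜ, (if i ∈ K then ({(0, true)} : Finset (Fin (M + 1) × Bool)) else
        if i ∈ F then Finset.univ.filter fun a : Fin (M + 1) × Bool => a.1 ≠ 0
        else Finset.univ).card = 2 * (M + 1) := by
      intro i hi
      rw [Finset.mem_compl] at hi
      rw [if_neg fun h => hi (hKF h), if_neg hi]
      simp [mul_comm]
    rw [Finset.prod_congr rfl h1, Finset.prod_congr rfl h2, Finset.prod_congr rfl h3]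
    simp [Finset.card_sdiff_of_subset hKF, hKk, Finset.card_compl]
  have hdisj : ∀ K ∈ F.powersetCard k, ∀ K' ∈ F.powersetCard k, K ≠ K' →
      Disjoint (B K) (B K') := by
    intro K hK K' hK' hne
    have hKF := (Finset.mem_powersetCard.1 hK).1
    have hKF' := (Finset.mem_powersetCard.1 hK').1
    rw [Finset.disjoint_left]
    intro u hu hu'
    obtain ⟨a1, a2⟩ := hB hKF hu
    obtain ⟨b1, b2⟩ := hB hKF' hu'
    refine hne (Finset.ext fun i => ⟨fun hi => ?_, fun hi => ?_⟩)
    · by_contra h; exact b2 i (hKF hi) h (by rw [a1 i hi])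
    · by_contra h; exact a2 i (hKF' hi) h (by rw [b1 i hi])
  calc _ = ((F.powersetCard k).biUnion B).card := by
        rw [Finset.card_biUnion hdisj, Finset.sum_congr rfl hcard]
        simp
    _ ≤ _ := by
        refine Finset.card_le_card fun u hu => ?_
        obtain ⟨K, hK, hu⟩ := Finset.mem_biUnion.1 hu
        obtain ⟨hKF, hKk⟩ := Finset.mem_powersetCard.1 hK
        obtain ⟨a1, a2⟩ := hB hKF hu
        have hsum : ∀ g : Fin (M + 1) × Bool → ℝ, g (0, true) = 1 → (∀ a, a.1 ≠ 0 → g a = 0) →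
            ∑ i ∈ F, g (u i) = k := by
          intro g g1 g0
          rw [← Finset.sum_sdiff hKF, Finset.sum_eq_zero, Finset.sum_congr rfl
            (g := fun _ => (1 : ℝ)) fun i hi => by rw [a1 i hi, g1]]
          · simp [hKk]
          · intro i hi
            obtain ⟨h1, h2⟩ := Finset.mem_sdiff.1 hi
            exact g0 _ (a2 i h1 h2)
        simp only [Finset.mem_filter, Finset.mem_univ, true_and]
        exact ⟨hsum _ (by simp [signedValue]) fun a ha => by simp [signedValue, ha],
          hsum (fun a => |signedValue a|) (by simp [signedValue]) fun a ha => by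
            simp [signedValue, ha]⟩

/-- Sparse signs: the tail at the level `k`. -/
theorem sparse_tail {ι : Type*} [DecidableEq ι] [Fintype ι] {n k M : ℕ} (hk : 1 ≤ k)
    (hkn : k ≤ n) (hι : Fintype.card ι = 2 * n) (hM : M + 1 = 2 * n / k)
    (F : Finset ι) (hF : n ≤ F.card) :
    Real.exp (-(6 * k)) * Fintype.card (ι → Fin (M + 1) × Bool) ≤
      (Finset.univ.filter fun u : ι → Fin (M + 1) × Bool =>
        (k : ℝ) ≤ ∑ i ∈ F, signedValue (u i) ∧
          ∑ i ∈ F, |signedValue (u i)| ≤ 4 * k).card := by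
  classical
  have hk0 : (0 : ℝ) < k := by exact_mod_cast hk
  have hn0 : (0 : ℝ) < n := by exact_mod_cast hk.trans hkn
  have hM1 : 1 ≤ M := by
    have : 2 ≤ 2 * n / k := (Nat.le_div_iff_mul_le hk).2 (by omega)
    omega
  have hM0 : (0 : ℝ) < M := by exact_mod_cast hM1
  have hMup : ((M : ℝ) + 1) * k ≤ 2 * n := by
    have := Nat.div_mul_le_self (2 * n) k
    rw [← hM] at this
    exact_mod_cast this
  have hMlow : (n : ℝ) ≤ 2 * M * k := by
    have h1 : 2 * n < 2 * n / k * k + k := Nat.lt_div_mul_add hk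
    rw [← hM] at h1
    have : 2 * n ≤ 4 * M * k := by nlinarith
    have : n ≤ 2 * M * k := by nlinarith
    exact_mod_cast this
  have hfk : k ≤ F.card := hkn.trans hF
  have hfN : F.card ≤ 2 * n := hι ▸ Finset.card_le_univ F
  have h1 := choose_mul_le_card_positive M k F
  have h1' : (F.card.choose k : ℝ) * ((2 * M) ^ (F.card - k) *
      (2 * (M + 1)) ^ (Fintype.card ι - F.card)) ≤
      (Finset.univ.filter fun u : ι → Fin (M + 1) × Bool =>
        (k : ℝ) ≤ ∑ i ∈ F, signedValue (u i) ∧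
          ∑ i ∈ F, |signedValue (u i)| ≤ 4 * k).card := by
    refine le_trans (by exact_mod_cast h1) (Nat.cast_le.2 (Finset.card_le_card fun u => ?_))
    simp only [Finset.mem_filter, Finset.mem_univ, true_and]
    rintro ⟨a, b⟩
    exact ⟨a.ge, by linarith⟩
  refine le_trans ?_ h1'
  have hchoose : ((n : ℝ) / k) ^ k ≤ F.card.choose k :=
    le_trans (pow_le_pow_left₀ (by positivity) (by gcongr) k) (div_pow_le_choose hfk)
  have hM2 : (0 : ℝ) < 2 * (M + 1) := by positivity
  -- Probability that the other letters of `F` vanish: at most `2n` factors, each at least `exp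
  -- (-1/M)`, and `2n / M ≤ 4k`.
  have hratio : Real.exp (-(4 * k)) ≤ ((M : ℝ) / (M + 1)) ^ (F.card - k) := by
    have hb : Real.exp (-(1 / M)) ≤ (M : ℝ) / (M + 1) := by
      rw [Real.exp_neg]
      have := Real.add_one_le_exp (1 / (M : ℝ))
      have h3 : (M : ℝ) / (M + 1) = (1 / (M : ℝ) + 1)⁻¹ := by field_simp; ring
      rw [h3]
      exact inv_anti₀ (by positivity) this
    calc Real.exp (-(4 * k)) ≤ Real.exp ((2 * n : ℕ) * -(1 / M)) := by
          refine Real.exp_le_exp.2 ?_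
          push_cast
          have : 2 * (n : ℝ) * (1 / M) ≤ 4 * k := by
            rw [mul_one_div, div_le_iff₀ hM0]; linarith
          linarith
      _ = Real.exp (-(1 / M)) ^ (2 * n) := by rw [Real.exp_nat_mul]
      _ ≤ ((M : ℝ) / (M + 1)) ^ (2 * n) := pow_le_pow_left₀ (Real.exp_pos _).le hb _
      _ ≤ _ := by
          refine pow_le_pow_of_le_one (by positivity) ?_ (by omega)
          rw [div_le_one (by positivity)]; linarith
  -- The choice of `k` places and their positive signs: each factor is at least `1/4 ≥ exp (-2)`, as
  -- `(M + 1) k ≤ 2n`.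
  have hfirst : Real.exp (-(2 * k)) ≤ ((n : ℝ) / k) ^ k * (1 / (2 * (M + 1))) ^ k := by
    rw [← mul_pow]
    have h4 : Real.exp (-2) ≤ (n : ℝ) / k * (1 / (2 * (M + 1))) := by
      have h5 : (4 : ℝ) ≤ Real.exp 2 := by
        have := Real.add_one_le_exp (1 : ℝ)
        have h6 : Real.exp 2 = Real.exp 1 ^ 2 := by rw [← Real.exp_nat_mul]; norm_num
        rw [h6]; nlinarith
      have h6 : Real.exp (-2) ≤ 1 / 4 := by
        rw [Real.exp_neg, one_div]; exact inv_anti₀ (by norm_num) h5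
      refine h6.trans ?_
      rw [div_mul_div_comm, div_le_div_iff₀ (by norm_num) (by positivity)]
      linarith
    calc Real.exp (-(2 * k)) = Real.exp (-2) ^ k := by rw [← Real.exp_nat_mul]; ring_nf
      _ ≤ _ := pow_le_pow_left₀ (Real.exp_pos _).le h4 k
  have hcardα : (Fintype.card (ι → Fin (M + 1) × Bool) : ℝ)
      = (2 * (M + 1)) ^ k * (2 * (M + 1)) ^ (F.card - k) *
        (2 * (M + 1)) ^ (Fintype.card ι - F.card) := by
    rw [← pow_add, ← pow_add, show k + (F.card - k) + (Fintype.card ι - F.card) = Fintype.card ι by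
      rw [hι]; omega]
    simp [mul_comm]
  calc Real.exp (-(6 * k)) * Fintype.card (ι → Fin (M + 1) × Bool)
      = (Real.exp (-(2 * k)) * Real.exp (-(4 * k))) *
        Fintype.card (ι → Fin (M + 1) × Bool) := by rw [← Real.exp_add]; ring_nf
    _ ≤ ((F.card.choose k * (1 / (2 * (M + 1))) ^ k) * ((M : ℝ) / (M + 1)) ^ (F.card - k)) *
        Fintype.card (ι → Fin (M + 1) × Bool) := by
        gcongr
        exact hfirst.trans (mul_le_mul_of_nonneg_right hchoose (by positivity))
    _ = _ := by
        rw [hcardα, one_div, inv_pow, mul_pow 2 (M : ℝ), div_pow, mul_pow 2 ((M : ℝ) + 1) (F.card - k)]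
        field_simp

/-- Markov's inequality for the number of nonzero letters. -/
theorem half_card_le_card_sparse {ι : Type*} [DecidableEq ι] [Fintype ι] {n k M : ℕ} (hk : 1 ≤ k)
    (hkn : k ≤ n) (hι : Fintype.card ι = 2 * n) (hM : M + 1 = 2 * n / k) :
    (Fintype.card (ι → Fin (M + 1) × Bool) : ℝ) / 2 ≤
      (Finset.univ.filter fun s : ι → Fin (M + 1) × Bool =>
        ∑ i, |signedValue (s i)| ≤ 4 * k).card := by
  classical
  have hk0 : (0 : ℝ) < k := by exact_mod_cast hk
  have hMlow : (n : ℝ) ≤ (M + 1) * k := by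
    have h1 : 2 * n < 2 * n / k * k + k := Nat.lt_div_mul_add hk
    rw [← hM] at h1
    have : n ≤ (M + 1) * k := by nlinarith
    exact_mod_cast this
  have hcoord : ∀ i : ι, ((M : ℝ) + 1) * ∑ s : ι → Fin (M + 1) × Bool, |signedValue (s i)|
      = Fintype.card (ι → Fin (M + 1) × Bool) := by
    intro i
    have h1 : ∑ s : ι → Fin (M + 1) × Bool, |signedValue (s i)|
        = (Fintype.piFinset fun j => if j = i then
          Finset.univ.filter fun a : Fin (M + 1) × Bool => a.1 = 0 else Finset.univ).card := by
      simp only [abs_signedValue, Finset.sum_boole]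
      congr 2
      ext s
      simp only [Finset.mem_filter, Finset.mem_univ, true_and, Fintype.mem_piFinset]
      constructor
      · intro h j
        by_cases hj : j = i
        · subst hj; simp [h]
        · simp [hj]
      · intro h; simpa using h i
    have h2 : Fintype.card (ι → Fin (M + 1) × Bool) = ∏ j : ι, Fintype.card (Fin (M + 1) × Bool) := by
      simp
    rw [h1, Fintype.card_piFinset, h2, ← Finset.mul_prod_erase _ _ (Finset.mem_univ i),
      ← Finset.mul_prod_erase _ _ (Finset.mem_univ i), if_pos rfl, card_fst_eq_zero]
    have h3 : ∏ j ∈ Finset.univ.erase i, (if j = i then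
        Finset.univ.filter fun a : Fin (M + 1) × Bool => a.1 = 0 else Finset.univ).card
        = ∏ j ∈ Finset.univ.erase i, Fintype.card (Fin (M + 1) × Bool) := by
      refine Finset.prod_congr rfl fun j hj => ?_
      rw [if_neg (Finset.ne_of_mem_erase hj), Finset.card_univ]
    rw [h3]
    push_cast
    simp only [Fintype.card_prod, Fintype.card_fin, Fintype.card_bool]
    push_cast
    ring
  have htotal : ((M : ℝ) + 1) * ∑ s : ι → Fin (M + 1) × Bool, ∑ i, |signedValue (s i)|
      = 2 * n * Fintype.card (ι → Fin (M + 1) × Bool) := by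
    rw [Finset.sum_comm, Finset.mul_sum, Finset.sum_congr rfl fun i _ => hcoord i]
    simp [hι]
  set C : ℝ := ((Fintype.card (ι → Fin (M + 1) × Bool) : ℕ) : ℝ) with hC
  have hC0 : 0 ≤ C := Nat.cast_nonneg _
  -- The mean number of nonzero letters, `2n / (M + 1)`, is at most `2k`, half the threshold.
  have hbound : ∑ s : ι → Fin (M + 1) × Bool, ∑ i, |signedValue (s i)| ≤ 2 * k * C := by
    have hM0 : (0 : ℝ) < (M : ℝ) + 1 := by positivity
    refine le_of_mul_le_mul_left ?_ hM0
    rw [htotal]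
    nlinarith
  have hlarge : 4 * k * ((Finset.univ.filter fun s : ι → Fin (M + 1) × Bool =>
      ¬ ∑ i, |signedValue (s i)| ≤ 4 * k).card : ℝ) ≤ 2 * k * C := by
    refine le_trans ?_ hbound
    rw [mul_comm, ← nsmul_eq_mul]
    refine le_trans (Finset.card_nsmul_le_sum _ _ _ fun s hs => ?_)
      (Finset.sum_le_sum_of_subset_of_nonneg (Finset.filter_subset _ _) fun s _ _ =>
        Finset.sum_nonneg fun i _ => abs_nonneg _)
    simp only [Finset.mem_filter, not_le] at hs
    exact hs.2.le
  have hpart := Finset.card_filter_add_card_filter_not (s := Finset.univ)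
    fun s : ι → Fin (M + 1) × Bool => ∑ i, |signedValue (s i)| ≤ 4 * k
  have hpart' : ((Finset.univ.filter fun s : ι → Fin (M + 1) × Bool =>
      ∑ i, |signedValue (s i)| ≤ 4 * k).card : ℝ) + ((Finset.univ.filter
      fun s : ι → Fin (M + 1) × Bool => ¬ ∑ i, |signedValue (s i)| ≤ 4 * k).card : ℝ) = C := by
    rw [hC, ← Finset.card_univ]
    exact_mod_cast hpart
  nlinarith

/-! ### Smooth functions as elements of Sobolev spaces -/

theorem contDiff_partialD {d : ℕ} (i : Fin d) {φ : (Fin d → ℝ) → ℝ}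
    (h : ContDiff ℝ (⊤ : ℕ∞) φ) : ContDiff ℝ (⊤ : ℕ∞) (partialD i φ) :=
  (h.fderiv_right (m := (⊤ : ℕ∞)) (by simp)).clm_apply contDiff_const

theorem tsupport_partialD_subset {d : ℕ} (i : Fin d) (φ : (Fin d → ℝ) → ℝ) :
    tsupport (partialD i φ) ⊆ tsupport φ := by
  refine (closure_mono fun x hx => ?_).trans (tsupport_fderiv_subset ℝ)
  rw [Function.mem_support] at hx ⊢
  intro h
  exact hx (by simp [partialD, h])

theorem integral_mul_partialD {d : ℕ} (i : Fin d) {f φ : (Fin d → ℝ) → ℝ}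
    (hf : ContDiff ℝ (⊤ : ℕ∞) f) (hφ : ContDiff ℝ (⊤ : ℕ∞) φ) (hc : HasCompactSupport φ) :
    ∫ x, f x * partialD i φ x = -∫ x, partialD i f x * φ x := by
  have hfφ : HasCompactSupport (partialD i φ) := hc.mono'
    ((subset_tsupport _).trans (tsupport_partialD_subset i φ))
  refine integral_mul_fderiv_eq_neg_fderiv_mul_of_integrable ?_ ?_ ?_
    (fun x _ => hf.differentiable (by simp) x) (fun x _ => hφ.differentiable (by simp) x)
  · exact ((contDiff_partialD i hf).continuous.mul hφ.continuous).integrable_of_hasCompactSupport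
      hc.mul_left
  · exact (hf.continuous.mul (contDiff_partialD i hφ).continuous).integrable_of_hasCompactSupport
      hfφ.mul_left
  · exact (hf.continuous.mul hφ.continuous).integrable_of_hasCompactSupport hc.mul_left

/-- The derivative `D^α φ`, with the partial derivatives taken in the order opposite to that of
`multiD`. This is the order in which integration by parts produces them. -/
noncomputable def multiDRev {d : ℕ} (α : Fin d → ℕ) (φ : (Fin d → ℝ) → ℝ) : (Fin d → ℝ) → ℝ :=
  (List.finRange d).foldl (fun ψ i => (partialD i)^[α i] ψ) φ

theorem multiDRev_zero {d : ℕ} (φ : (Fin d → ℝ) → ℝ) : multiDRev 0 φ = φ := by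
  rw [multiDRev]
  induction List.finRange d with
  | nil => rfl
  | cons i l ih => simp

/-- A relation that is compatible with partial derivatives is compatible with `multiDRev`. -/
theorem multiDRev_induction {d : ℕ} (R : ℕ → ((Fin d → ℝ) → ℝ) → ((Fin d → ℝ) → ℝ) → Prop)
    (hR : ∀ k i ψ χ, R k ψ χ → R (k + 1) (partialD i ψ) (partialD i χ))
    (α : Fin d → ℕ) {φ φ' : (Fin d → ℝ) → ℝ} (h : R 0 φ φ') :
    R (∑ i, α i) (multiDRev α φ) (multiDRev α φ') := by
  have hit : ∀ (i : Fin d) (a k : ℕ) (ψ χ), R k ψ χ →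
      R (k + a) ((partialD i)^[a] ψ) ((partialD i)^[a] χ) := by
    intro i a
    induction a with
    | zero => intro k ψ χ h; exact h
    | succ a ih =>
      intro k ψ χ h
      have := ih (k + 1) _ _ (hR k i ψ χ h)
      rwa [add_right_comm, add_assoc] at this
  have key : ∀ (l : List (Fin d)) (k : ℕ) (ψ χ), R k ψ χ →
      R (k + (l.map α).sum) (l.foldl (fun ψ i => (partialD i)^[α i] ψ) ψ)
        (l.foldl (fun ψ i => (partialD i)^[α i] ψ) χ) := by
    intro l
    induction l with
    | nil => intro k ψ χ h; simpa using h
    | cons i l ih =>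
      intro k ψ χ h
      have := ih (k + α i) _ _ (hit i (α i) k ψ χ h)
      simpa [add_assoc] using this
  have := key (List.finRange d) 0 φ φ' h
  rwa [zero_add, ← Fin.sum_univ_def] at this

theorem contDiff_multiDRev {d : ℕ} (α : Fin d → ℕ) {φ : (Fin d → ℝ) → ℝ}
    (h : ContDiff ℝ (⊤ : ℕ∞) φ) : ContDiff ℝ (⊤ : ℕ∞) (multiDRev α φ) :=
  multiDRev_induction (fun _ ψ _ => ContDiff ℝ (⊤ : ℕ∞) ψ)
    (fun _ i _ _ h => contDiff_partialD i h) α (φ' := φ) h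

theorem tsupport_multiDRev_subset {d : ℕ} (α : Fin d → ℕ) (φ : (Fin d → ℝ) → ℝ) :
    tsupport (multiDRev α φ) ⊆ tsupport φ :=
  multiDRev_induction (fun _ ψ _ => tsupport ψ ⊆ tsupport φ)
    (fun _ i _ _ h => (tsupport_partialD_subset i _).trans h) α (φ' := φ) Subset.rfl

/-- Each integration by parts moves the outermost derivative of `φ` onto `f`, so the `foldr` becomes
a `foldl` and no symmetry of mixed derivatives is needed. -/
theorem integral_mul_multiD {d : ℕ} (α : Fin d → ℕ) {f φ : (Fin d → ℝ) → ℝ}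
    (hf : ContDiff ℝ (⊤ : ℕ∞) f) (hφ : ContDiff ℝ (⊤ : ℕ∞) φ) (hc : HasCompactSupport φ) :
    tsupport (multiD α φ) ⊆ tsupport φ ∧
      ∫ x, f x * multiD α φ x = (-1) ^ (∑ i, α i) * ∫ x, multiDRev α f x * φ x := by
  have hcs : ∀ {ψ : (Fin d → ℝ) → ℝ}, tsupport ψ ⊆ tsupport φ → HasCompactSupport ψ :=
    fun h => hc.mono' ((subset_tsupport _).trans h)
  have hit : ∀ (i : Fin d) (a : ℕ) (ψ : (Fin d → ℝ) → ℝ), ContDiff ℝ (⊤ : ℕ∞) ψ →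
      tsupport ψ ⊆ tsupport φ → ContDiff ℝ (⊤ : ℕ∞) ((partialD i)^[a] ψ) ∧
      tsupport ((partialD i)^[a] ψ) ⊆ tsupport φ ∧
      ∀ g : (Fin d → ℝ) → ℝ, ContDiff ℝ (⊤ : ℕ∞) g → ContDiff ℝ (⊤ : ℕ∞) ((partialD i)^[a] g) ∧
        ∫ x, g x * (partialD i)^[a] ψ x = (-1) ^ a * ∫ x, (partialD i)^[a] g x * ψ x := by
    intro i a
    induction a with
    | zero => intro ψ h1 h2; exact ⟨h1, h2, fun g hg => ⟨hg, by simp⟩⟩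
    | succ a ih =>
      intro ψ h1 h2
      obtain ⟨i1, i2, i3⟩ := ih (partialD i ψ) (contDiff_partialD i h1)
        ((tsupport_partialD_subset i ψ).trans h2)
      refine ⟨i1, i2, fun g hg => ?_⟩
      obtain ⟨j1, j2⟩ := i3 g hg
      rw [Function.iterate_succ_apply _ _ ψ, j2, integral_mul_partialD i j1 h1 (hcs h2),
        Function.iterate_succ_apply' _ _ g]
      exact ⟨contDiff_partialD i j1, by rw [pow_succ]; ring⟩
  have key : ∀ l : List (Fin d),
      ContDiff ℝ (⊤ : ℕ∞) (l.foldr (fun i ψ => (partialD i)^[α i] ψ) φ) ∧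
      tsupport (l.foldr (fun i ψ => (partialD i)^[α i] ψ) φ) ⊆ tsupport φ ∧
      ∀ g : (Fin d → ℝ) → ℝ, ContDiff ℝ (⊤ : ℕ∞) g →
        ∫ x, g x * l.foldr (fun i ψ => (partialD i)^[α i] ψ) φ x = (-1) ^ (l.map α).sum *
          ∫ x, l.foldl (fun ψ i => (partialD i)^[α i] ψ) g x * φ x := by
    intro l
    induction l with
    | nil => exact ⟨hφ, Subset.rfl, fun g _ => by simp⟩
    | cons i l ih =>
      obtain ⟨h1, h2, h3⟩ := ih
      obtain ⟨i1, i2, i3⟩ := hit i (α i) _ h1 h2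
      refine ⟨i1, i2, fun g hg => ?_⟩
      obtain ⟨j1, j2⟩ := i3 g hg
      rw [List.foldr_cons, j2, h3 _ j1, List.map_cons, List.sum_cons, pow_add, List.foldl_cons,
        mul_assoc]
  obtain ⟨_, h2, h3⟩ := key (List.finRange d)
  refine ⟨h2, ?_⟩
  rw [Fin.sum_univ_def]
  exact h3 f hf

theorem isWeakDeriv_multiDRev {d : ℕ} (U : Set (Fin d → ℝ)) (α : Fin d → ℕ)
    {f : (Fin d → ℝ) → ℝ} (hf : ContDiff ℝ (⊤ : ℕ∞) f) : IsWeakDeriv U α f (multiDRev α f) := by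
  refine ⟨hf.continuous.locallyIntegrable.locallyIntegrableOn U,
    (contDiff_multiDRev α hf).continuous.locallyIntegrable.locallyIntegrableOn U,
    fun φ hφ hc hU => ?_⟩
  obtain ⟨h1, h2⟩ := integral_mul_multiD α hf hφ hc
  rw [setIntegral_eq_integral_of_forall_compl_eq_zero, h2,
    setIntegral_eq_integral_of_forall_compl_eq_zero]
  · intro x hx
    rw [image_eq_zero_of_notMem_tsupport fun h => hx (hU h), mul_zero]
  · intro x hx
    rw [image_eq_zero_of_notMem_tsupport fun h => hx (hU (h1 h)), mul_zero]

/-- The factor `s.card ^ (1 / p)` is at most `s.card`, which keeps the constants independent of `p`.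
-/
theorem lpSum_le_card_mul {ι : Type*} {p : ℝ≥0∞} (hp : 1 ≤ p) {s : Finset ι} (hs : s.Nonempty)
    {v : ι → ℝ≥0∞} {x : ℝ≥0∞} (h : ∀ a ∈ s, v a ≤ x) : lpSum p s v ≤ s.card * x := by
  have hcard : (1 : ℝ≥0∞) ≤ s.card := by exact_mod_cast hs.card_pos
  rw [lpSum]
  split_ifs with hptop
  · exact (Finset.sup_le h).trans (le_mul_of_one_le_left' hcard)
  · have hp1 : 1 ≤ p.toReal := by
      rw [← ENNReal.toReal_one]; exact ENNReal.toReal_mono hptop hp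
    have hp0 : 0 < p.toReal := by linarith
    calc (∑ a ∈ s, v a ^ p.toReal) ^ (1 / p.toReal)
        ≤ (∑ _a ∈ s, x ^ p.toReal) ^ (1 / p.toReal) := by
          gcongr with a ha
          exact h a ha
      _ = (s.card : ℝ≥0∞) ^ (1 / p.toReal) * x := by
          rw [Finset.sum_const, nsmul_eq_mul, ENNReal.mul_rpow_of_nonneg _ _ (by positivity),
            ← ENNReal.rpow_mul, mul_one_div_cancel hp0.ne', ENNReal.rpow_one]
      _ ≤ (s.card : ℝ≥0∞) * x := by
          gcongr
          calc (s.card : ℝ≥0∞) ^ (1 / p.toReal) ≤ (s.card : ℝ≥0∞) ^ (1 : ℝ) :=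
                ENNReal.rpow_le_rpow_of_exponent_le hcard (by
                  rw [div_le_one hp0]; exact hp1)
            _ = s.card := ENNReal.rpow_one _

/-- For smooth `f` the classical derivatives are an admissible family. The volume of `D` is how
sparsity enters the norm. For `p = ∞` the convention `1 / 0 = 0` makes the volume factor `1`, as it
should be. -/
theorem sobolevNorm_le_of_bound {d r : ℕ} {p : ℝ≥0∞} (hp : 1 ≤ p) (G : Set (Fin d → ℝ))
    {f : (Fin d → ℝ) → ℝ} (hf : ContDiff ℝ (⊤ : ℕ∞) f) (D : Set (Fin d → ℝ)) {B : ℝ}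
    (hD : ∀ α ∈ multiIndices d r, ∀ x, x ∉ D → multiDRev α f x = 0)
    (hB : ∀ α ∈ multiIndices d r, ∀ x, |multiDRev α f x| ≤ B) :
    sobolevNorm r p G f ≤
      (multiIndices d r).card * (ENNReal.ofReal B * volume D ^ (1 / p.toReal)) := by
  have h0 : (0 : Fin d → ℕ) ∈ multiIndices d r := by simp [mem_multiIndices]
  refine (iInf₂_le (fun α => multiDRev α f)
    ⟨multiDRev_zero f, fun α _ _ => isWeakDeriv_multiDRev _ α hf⟩).trans ?_
  refine lpSum_le_card_mul hp ⟨0, h0⟩ fun α hα => ?_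
  refine (eLpNorm_mono_measure _ Measure.restrict_le_self).trans ?_
  have hB0 : 0 ≤ B := (abs_nonneg _).trans (hB 0 h0 0)
  calc eLpNorm (multiDRev α f) p volume
      ≤ eLpNorm (D.indicator fun _ => B) p volume := by
        refine eLpNorm_mono fun x => ?_
        by_cases hx : x ∈ D
        · rw [indicator_of_mem hx, Real.norm_eq_abs, Real.norm_eq_abs, abs_of_nonneg hB0]
          exact hB α hα x
        · rw [hD α hα x hx, norm_zero]; exact norm_nonneg _
    _ ≤ ‖B‖ₑ * volume D ^ (1 / p.toReal) := eLpNorm_indicator_const_le B p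
    _ = _ := by rw [Real.enorm_of_nonneg hB0]

/-! ### A system of disjoint bumps -/

/-- Chain rule: every derivative yields one factor `l`, counted by the index `k` of the relation in
`multiDRev_induction`. -/
theorem multiDRev_sum_scaled {d : ℕ} {ι : Type*} [Fintype ι] (α : Fin d → ℕ)
    {b : (Fin d → ℝ) → ℝ} (hb : ContDiff ℝ (⊤ : ℕ∞) b) (l : ℝ) (v : ι → ℝ)
    (c : ι → Fin d → ℝ) :
    multiDRev α (fun x => ∑ i, v i * b (l • (x - c i))) =
      fun x => ∑ i, v i * (l ^ (∑ j, α j) * multiDRev α b (l • (x - c i))) := by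
  have := multiDRev_induction (fun k ψ χ => ContDiff ℝ (⊤ : ℕ∞) χ ∧
    ψ = fun x => ∑ i, v i * (l ^ k * χ (l • (x - c i)))) ?_ α (φ' := b)
    (φ := fun x => ∑ i, v i * b (l • (x - c i))) ⟨hb, by simp⟩
  · exact this.2
  · rintro k j ψ χ ⟨hχ, rfl⟩
    refine ⟨contDiff_partialD j hχ, ?_⟩
    funext x
    have hterm : ∀ i, HasFDerivAt (fun x => v i * (l ^ k * χ (l • (x - c i))))
        (v i • l ^ k • (fderiv ℝ χ (l • (x - c i))).comp
          (l • ContinuousLinearMap.id ℝ (Fin d → ℝ))) x := by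
      intro i
      have h1 : HasFDerivAt (fun x : Fin d → ℝ => l • (x - c i))
          (l • ContinuousLinearMap.id ℝ (Fin d → ℝ)) x :=
        ((hasFDerivAt_id x).sub_const (c i)).const_smul l
      have h2 : HasFDerivAt χ (fderiv ℝ χ (l • (x - c i))) (l • (x - c i)) :=
        (hχ.differentiable (by simp) _).hasFDerivAt
      exact ((h2.comp x h1).const_mul (l ^ k)).const_mul (v i)
    have hsum := HasFDerivAt.fun_sum (u := Finset.univ) fun i _ => hterm i
    rw [partialD, hsum.fderiv]
    simp only [sum_apply, smul_apply,
      ContinuousLinearMap.comp_apply, ContinuousLinearMap.id_apply, map_smul, smul_eq_mul, partialD]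
    refine Finset.sum_congr rfl fun i _ => ?_
    ring

/-- A grid with `m` points per axis has room for `2n` bumps, with mesh still of order `n^{-1/d}`. -/
theorem exists_grid_size {d n : ℕ} (hd : 1 ≤ d) (hn : 1 ≤ n) :
    ∃ m : ℕ, 1 ≤ m ∧ 2 * n ≤ m ^ d ∧ (m : ℝ) ≤ 4 * (n : ℝ) ^ (1 / (d : ℝ)) := by
  have hd0 : (0 : ℝ) < d := by exact_mod_cast hd
  have hn1 : (1 : ℝ) ≤ n := by exact_mod_cast hn
  have h1d : 1 / (d : ℝ) ≤ 1 := by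
    rw [div_le_one hd0]; exact_mod_cast hd
  have hx1 : (1 : ℝ) ≤ (2 * n : ℝ) ^ (1 / (d : ℝ)) :=
    Real.one_le_rpow (by linarith) (by positivity)
  have hx2 : (2 * n : ℝ) ^ (1 / (d : ℝ)) ≤ 2 * (n : ℝ) ^ (1 / (d : ℝ)) := by
    rw [Real.mul_rpow (by norm_num) (by positivity)]
    refine mul_le_mul_of_nonneg_right ?_ (by positivity)
    calc (2 : ℝ) ^ (1 / (d : ℝ)) ≤ 2 ^ (1 : ℝ) :=
          Real.rpow_le_rpow_of_exponent_le (by norm_num) h1d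
      _ = 2 := Real.rpow_one 2
  refine ⟨⌈(2 * n : ℝ) ^ (1 / (d : ℝ))⌉₊, Nat.one_le_ceil_iff.2 (by linarith), ?_, ?_⟩
  · have h : ((2 * n : ℝ) ^ (1 / (d : ℝ))) ^ d ≤
        (⌈(2 * n : ℝ) ^ (1 / (d : ℝ))⌉₊ : ℝ) ^ d :=
      pow_le_pow_left₀ (by positivity) (Nat.le_ceil _) d
    rw [← Real.rpow_natCast, ← Real.rpow_mul (by positivity), one_div_mul_cancel hd0.ne',
      Real.rpow_one] at h
    exact_mod_cast h
  · have := Nat.ceil_lt_add_one (show 0 ≤ (2 * n : ℝ) ^ (1 / (d : ℝ)) by positivity)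
    linarith

theorem abs_sum_le_of_subsingleton_support {ι : Type*} [Fintype ι] {f : ι → ℝ} {B : ℝ}
    (hB : 0 ≤ B) (hf : ∀ i, |f i| ≤ B) (h : ∀ i j, f i ≠ 0 → f j ≠ 0 → i = j) :
    |∑ i, f i| ≤ B := by
  by_cases hex : ∃ i, f i ≠ 0
  · obtain ⟨i, hi⟩ := hex
    rw [Finset.sum_eq_single i (fun j _ hj => by_contra fun hne => hj (h j i hne hi))
      (fun h => absurd (Finset.mem_univ i) h)]
    exact hf i
  · push Not at hex
    simpa [hex] using hB

/-- There is a smooth bump near the origin, with a common bound of its derivatives. -/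
theorem exists_bump (d r : ℕ) : ∃ (b : (Fin d → ℝ) → ℝ) (C : ℝ), 0 < C ∧
    ContDiff ℝ (⊤ : ℕ∞) b ∧ 0 < ∫ x, b x ∧
    (∀ α x, multiDRev α b x ≠ 0 → ‖x‖ ≤ 1 / 8) ∧
    ∀ α ∈ multiIndices d r, ∀ x, |multiDRev α b x| ≤ C := by
  let b : ContDiffBump (0 : Fin d → ℝ) := ⟨1 / 16, 1 / 8, by norm_num, by norm_num⟩
  have hb : ContDiff ℝ (⊤ : ℕ∞) b := b.contDiff
  have hbound : ∀ α : Fin d → ℕ, ∃ C, ∀ x, ‖multiDRev α b x‖ ≤ C := fun α =>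
    (contDiff_multiDRev α hb).continuous.bounded_above_of_compact_support
      (b.hasCompactSupport.mono' ((subset_tsupport _).trans (tsupport_multiDRev_subset α b)))
  choose C hC using hbound
  have hC0 : ∀ α, 0 ≤ C α := fun α => (norm_nonneg _).trans (hC α 0)
  refine ⟨b, ∑ α ∈ multiIndices d r, C α + 1, ?_, hb, b.integral_pos, ?_, ?_⟩
  · have := Finset.sum_nonneg fun α (_ : α ∈ multiIndices d r) => hC0 α
    linarith
  · intro α x hx
    have : x ∈ tsupport b := tsupport_multiDRev_subset α b (subset_tsupport _ hx)
    rw [b.tsupport_eq] at this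
    simpa [b] using this
  · intro α hα x
    have := Finset.single_le_sum (fun α _ => hC0 α) hα
    have := hC α x
    rw [Real.norm_eq_abs] at this
    linarith

/-- For every `n` there are `2n` functions with disjoint supports, such that the combinations with
coefficients in `[-1, 1]`, normalized according to the number of nonzero coefficients, belong to the
unit ball of the Sobolev space. -/
theorem exists_bump_system {d : ℕ} (hd : 1 ≤ d) (r : ℕ) {G : Set (Fin d → ℝ)}
    (hG : (interior G).Nonempty) :
    ∃ c : ℝ, 0 < c ∧ ∀ n : ℕ, 1 ≤ n → ∃ (φ : Fin (2 * n) → (Fin d → ℝ) → ℝ) (J : ℝ),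
      c * (n : ℝ) ^ (-((r : ℝ) / d)) / n ≤ J ∧
      (∀ i j x, φ i x ≠ 0 → φ j x ≠ 0 → i = j) ∧
      ∀ p : ℝ≥0∞, 1 ≤ p → ∀ w : ℝ, 0 < w → ∀ v : Fin (2 * n) → ℝ, (∀ i, |v i| ≤ 1) →
        ((Finset.univ.filter fun i => v i ≠ 0).card : ℝ) ≤ 2 * w →
        (fun x => ∑ i, (n / w : ℝ) ^ (1 / p.toReal) * v i * φ i x)
          ∈ continuousSobolevSpace r p G ∧
        sobolevNorm r p G (fun x => ∑ i, (n / w : ℝ) ^ (1 / p.toReal) * v i * φ i x) ≤ 1 ∧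
        ∫ x in G, ∑ i, (n / w : ℝ) ^ (1 / p.toReal) * v i * φ i x
          = (n / w : ℝ) ^ (1 / p.toReal) * J * ∑ i, v i := by
  obtain ⟨b, C, hC, hb, hJ0, hsupp, hbd⟩ := exists_bump d r
  have hd0 : (0 : ℝ) < d := by exact_mod_cast hd
  obtain ⟨x₀, ρ, hρ, hρ1, hball⟩ : ∃ (x₀ : Fin d → ℝ) (ρ : ℝ), 0 < ρ ∧ ρ ≤ 1 ∧
      Metric.closedBall x₀ ρ ⊆ interior G := by
    obtain ⟨x₀, hx₀⟩ := hG
    obtain ⟨ε, hε, h⟩ := Metric.nhds_basis_closedBall.mem_iff.1 (isOpen_interior.mem_nhds hx₀)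
    exact ⟨x₀, min ε 1, lt_min hε one_pos, min_le_right _ _,
      (Metric.closedBall_subset_closedBall (min_le_left _ _)).trans h⟩
  set A : ℝ := ((multiIndices d r).card : ℝ) with hA
  have hA0 : 0 < A := by
    have : (0 : Fin d → ℕ) ∈ multiIndices d r := by simp [mem_multiIndices]
    exact Nat.cast_pos.2 (Finset.card_pos.2 ⟨0, this⟩)
  set J₀ : ℝ := ∫ x, b x with hJ₀
  refine ⟨J₀ / (A * C) * (ρ / 4) ^ (r + d), by positivity, fun n hn => ?_⟩
  obtain ⟨m, hm, hmd, hmn⟩ := exists_grid_size hd hn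
  have hn0 : (0 : ℝ) < n := by exact_mod_cast hn
  have hm0 : (0 : ℝ) < m := by exact_mod_cast hm
  obtain ⟨e⟩ : Nonempty (Fin (2 * n) ↪ (Fin d → Fin m)) :=
    Function.Embedding.nonempty_of_card_le (by simpa using hmd)
  set l : ℝ := m / ρ with hl
  have hl0 : 0 < l := by positivity
  have hml : (m : ℝ) ≤ l := by rw [hl, le_div_iff₀ hρ]; nlinarith
  have hl1 : 1 ≤ l := le_trans (by exact_mod_cast hm) hml
  -- Grid of spacing `1 / (2 * l)`. After scaling by `l` the centres are `1/2` apart while the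
  -- supports have radius at most `1/8`, and `m / (2 * l) = ρ / 2` leaves them inside the ball.
  let c : Fin (2 * n) → Fin d → ℝ := fun i j => x₀ j + (e i j : ℕ) / (2 * l)
  have hcoord : ∀ i x, ‖l • (x - c i)‖ ≤ 1 / 8 → ∀ j, |l * (x j - x₀ j) - (e i j : ℕ) / 2| ≤ 1 / 8 := by
    intro i x hx j
    have h1 := (norm_le_pi_norm (l • (x - c i)) j).trans hx
    have h2 : (l • (x - c i)) j = l * (x j - x₀ j) - (e i j : ℕ) / 2 := by
      change l * (x j - (x₀ j + (e i j : ℕ) / (2 * l))) = _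
      field_simp
      ring
    rwa [Real.norm_eq_abs, h2] at h1
  have hsep : ∀ i j x, ‖l • (x - c i)‖ ≤ 1 / 8 → ‖l • (x - c j)‖ ≤ 1 / 8 → i = j := by
    intro i j x hi hj
    refine e.injective (funext fun q => Fin.ext ?_)
    have h1 := abs_le.1 (hcoord i x hi q)
    have h2 := abs_le.1 (hcoord j x hj q)
    have h3 : ((e i q : ℕ) : ℝ) < (e j q : ℕ) + 1 := by linarith [h1.1, h1.2, h2.1, h2.2]
    have h4 : ((e j q : ℕ) : ℝ) < (e i q : ℕ) + 1 := by linarith [h1.1, h1.2, h2.1, h2.2]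
    have h3' : (e i q : ℕ) < e j q + 1 := by exact_mod_cast h3
    have h4' : (e j q : ℕ) < e i q + 1 := by exact_mod_cast h4
    omega
  have hin : ∀ i x, ‖l • (x - c i)‖ ≤ 1 / 8 → x ∈ Metric.closedBall x₀ ρ := by
    intro i x hx
    rw [Metric.mem_closedBall, dist_pi_le_iff hρ.le]
    intro j
    have h1 := abs_le.1 (hcoord i x hx j)
    have h2 : ((e i j : ℕ) : ℝ) ≤ m := by exact_mod_cast (e i j).2.le
    have h3 : (0 : ℝ) ≤ (e i j : ℕ) := Nat.cast_nonneg _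
    have h4 : (1 : ℝ) ≤ m := by exact_mod_cast hm
    have h5 : l * |x j - x₀ j| ≤ l * ρ := by
      have : l * ρ = m := by rw [hl]; field_simp
      rw [this, ← abs_of_pos hl0, ← abs_mul, abs_le]
      constructor <;> linarith [h1.1, h1.2]
    rw [Real.dist_eq]
    exact le_of_mul_le_mul_left h5 hl0
  -- With this factor all derivatives up to order `r` are at most `1 / A`; the `A` absorbs the
  -- number of multi-indices in the norm.
  set κ : ℝ := (A * C * l ^ r)⁻¹ with hκ
  have hκ0 : 0 < κ := by positivity
  have hsupp0 : ∀ x, b x ≠ 0 → ‖x‖ ≤ 1 / 8 := fun x hx =>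
    hsupp 0 x (by rwa [multiDRev_zero])
  refine ⟨fun i x => κ * b (l • (x - c i)), κ * ((l ^ d)⁻¹ * J₀), ?_, ?_, ?_⟩
  · have hmpow : (m : ℝ) ^ (r + d) ≤ 4 ^ (r + d) * ((n : ℝ) ^ ((r : ℝ) / d) * n) := by
      calc (m : ℝ) ^ (r + d) ≤ (4 * (n : ℝ) ^ (1 / (d : ℝ))) ^ (r + d) :=
            pow_le_pow_left₀ hm0.le hmn _
        _ = 4 ^ (r + d) * ((n : ℝ) ^ ((r : ℝ) / d) * n) := by
            rw [mul_pow, ← Real.rpow_natCast ((n : ℝ) ^ (1 / (d : ℝ))),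
              ← Real.rpow_mul hn0.le]
            congr 1
            nth_rewrite 3 [← Real.rpow_one (n : ℝ)]
            rw [← Real.rpow_add hn0]
            congr 1
            push_cast
            field_simp
    rw [Real.rpow_neg hn0.le]
    have hX : 0 < (n : ℝ) ^ ((r : ℝ) / d) := by positivity
    calc J₀ / (A * C) * (ρ / 4) ^ (r + d) * ((n : ℝ) ^ ((r : ℝ) / d))⁻¹ / n
        = J₀ / (A * C) * ρ ^ (r + d) * (4 ^ (r + d) * ((n : ℝ) ^ ((r : ℝ) / d) * n))⁻¹ := by
          rw [div_pow]; field_simp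
      _ ≤ J₀ / (A * C) * ρ ^ (r + d) * ((m : ℝ) ^ (r + d))⁻¹ := by
          gcongr
      _ = κ * ((l ^ d)⁻¹ * J₀) := by
          rw [hκ, hl, div_pow, div_pow, pow_add, pow_add]; field_simp
  · intro i j x hi hj
    exact hsep i j x (hsupp0 _ (right_ne_zero_of_mul hi)) (hsupp0 _ (right_ne_zero_of_mul hj))
  intro p hp w hw v hv hcard
  set K : ℝ := (n / w : ℝ) ^ (1 / p.toReal) with hK
  have hK0 : 0 < K := by positivity
  have hform : (fun x => ∑ i, K * v i * (κ * b (l • (x - c i))))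
      = fun x => ∑ i, (K * v i * κ) * b (l • (x - c i)) := by
    funext x
    exact Finset.sum_congr rfl fun i _ => by ring
  simp only [hform]
  have hsmooth : ContDiff ℝ (⊤ : ℕ∞) fun x => ∑ i, (K * v i * κ) * b (l • (x - c i)) :=
    ContDiff.sum fun i _ => contDiff_const.mul
      (hb.comp ((contDiff_id.sub contDiff_const).const_smul l))
  have hzero : ∀ x, x ∉ Metric.closedBall x₀ ρ → ∑ i, (K * v i * κ) * b (l • (x - c i)) = 0 := by
    intro x hx
    refine Finset.sum_eq_zero fun i _ => ?_
    by_contra h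
    exact hx (hin i x (hsupp0 _ (right_ne_zero_of_mul h)))
  have hcs : HasCompactSupport fun x => ∑ i, (K * v i * κ) * b (l • (x - c i)) :=
    HasCompactSupport.intro (isCompact_closedBall x₀ ρ) hzero
  have hnorm : sobolevNorm r p G (fun x => ∑ i, (K * v i * κ) * b (l • (x - c i))) ≤ 1 := by
    let S : Finset (Fin (2 * n)) := Finset.univ.filter fun i => v i ≠ 0
    have h := sobolevNorm_le_of_bound (r := r) hp G hsmooth
      (⋃ i ∈ S, Metric.closedBall (c i) (1 / (8 * l))) (B := K / A) ?_ ?_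
    · refine h.trans ?_
      -- At most `2 * w` balls are active, each of volume at most `1 / (2 * n)`. Hence the volume
      -- factor in the norm is at most `K⁻¹` and cancels the amplitude `K`.
      have hvol : volume (⋃ i ∈ S, Metric.closedBall (c i) (1 / (8 * l)))
          ≤ ENNReal.ofReal (w / n) := by
        refine (measure_biUnion_finset_le _ _).trans ?_
        simp only [Real.volume_pi_closedBall _ (show 0 ≤ 1 / (8 * l) by positivity),
          Finset.sum_const, nsmul_eq_mul, Fintype.card_fin]
        rw [← ENNReal.ofReal_natCast, ← ENNReal.ofReal_mul (Nat.cast_nonneg _)]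
        refine ENNReal.ofReal_le_ofReal ?_
        have h1 : (2 * (1 / (8 * l))) ^ d ≤ 1 / (2 * n) := by
          calc (2 * (1 / (8 * l))) ^ d ≤ (1 / (m : ℝ)) ^ d := by
                refine pow_le_pow_left₀ (by positivity) ?_ d
                rw [mul_one_div, div_le_div_iff₀ (by positivity) hm0]
                linarith
            _ = 1 / (m : ℝ) ^ d := by rw [div_pow, one_pow]
            _ ≤ 1 / (2 * n) := by
                refine one_div_le_one_div_of_le (by positivity) ?_
                exact_mod_cast hmd
        calc (S.card : ℝ) * (2 * (1 / (8 * l))) ^ d ≤ 2 * w * (1 / (2 * n)) :=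
              mul_le_mul hcard h1 (by positivity) (by positivity)
          _ = w / n := by field_simp
      have hpow : volume (⋃ i ∈ S, Metric.closedBall (c i) (1 / (8 * l))) ^ (1 / p.toReal)
          ≤ ENNReal.ofReal K⁻¹ := by
        refine (ENNReal.rpow_le_rpow hvol (by positivity)).trans_eq ?_
        rw [ENNReal.ofReal_rpow_of_pos (by positivity), hK, ← Real.inv_rpow (by positivity), inv_div]
      calc _ ≤ ((multiIndices d r).card : ℝ≥0∞) * (ENNReal.ofReal (K / A) * ENNReal.ofReal K⁻¹) := by
            gcongr
        _ = 1 := by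
            rw [← ENNReal.ofReal_natCast, ← hA, ← ENNReal.ofReal_mul (by positivity),
              ← ENNReal.ofReal_mul hA0.le, ← ENNReal.ofReal_one]
            congr 1
            field_simp
    · intro α _ x hx
      rw [multiDRev_sum_scaled α hb]
      refine Finset.sum_eq_zero fun i _ => ?_
      by_contra hne
      have hvi : v i ≠ 0 := fun h0 => hne (by simp [h0])
      have h1 := hsupp α _ (right_ne_zero_of_mul (right_ne_zero_of_mul hne))
      refine hx (mem_iUnion₂.2 ⟨i, by simp [S, hvi], ?_⟩)
      rw [norm_smul, Real.norm_eq_abs, abs_of_pos hl0] at h1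
      rw [Metric.mem_closedBall, dist_eq_norm, le_div_iff₀ (by positivity)]
      linarith
    · intro α hα x
      rw [multiDRev_sum_scaled α hb]
      refine abs_sum_le_of_subsingleton_support (by positivity) (fun i => ?_) fun i j hi hj => ?_
      · rw [abs_mul, abs_mul, abs_mul, abs_mul, abs_of_pos hK0, abs_of_pos hκ0,
          abs_of_pos (pow_pos hl0 _)]
        have h1 : l ^ (∑ j, α j) ≤ l ^ r := pow_le_pow_right₀ hl1 (mem_multiIndices.1 hα)
        calc K * |v i| * κ * (l ^ (∑ j, α j) * |multiDRev α b (l • (x - c i))|)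
            ≤ K * 1 * κ * (l ^ r * C) := by
              gcongr
              · exact hv i
              · exact hbd α hα _
          _ = K / A := by rw [hκ]; field_simp
      · exact hsep i j x (hsupp α _ (right_ne_zero_of_mul (right_ne_zero_of_mul hi)))
          (hsupp α _ (right_ne_zero_of_mul (right_ne_zero_of_mul hj)))
  refine ⟨⟨⟨(hsmooth.continuous.memLp_of_hasCompactSupport hcs).restrict G,
    hnorm.trans_lt ENNReal.one_lt_top,
    (hsmooth.continuous.integrable_of_hasCompactSupport hcs).integrableOn⟩,
    hsmooth.continuous.continuousOn⟩, hnorm, ?_⟩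
  rw [setIntegral_eq_integral_of_forall_compl_eq_zero fun x hx =>
    hzero x fun h => hx (interior_subset (hball h))]
  have hbcs : HasCompactSupport b :=
    HasCompactSupport.intro (isCompact_closedBall 0 (1 / 8)) fun x hx => by
      by_contra h
      exact hx (by simpa using hsupp0 x h)
  have hbint : Integrable b := hb.continuous.integrable_of_hasCompactSupport hbcs
  have hbump : ∀ i, Integrable fun x => b (l • (x - c i)) := fun i =>
    (hbint.comp_smul hl0.ne').comp_sub_right (c i)
  have hval : ∀ i, ∫ x, b (l • (x - c i)) = (l ^ d)⁻¹ * J₀ := by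
    intro i
    rw [integral_sub_right_eq_self (fun x => b (l • x)) (c i), Measure.integral_comp_smul]
    simp [abs_of_pos hl0, hJ₀]
  rw [integral_finsetSum _ fun i _ => (hbump i).const_mul _]
  simp only [integral_const_mul, hval]
  rw [← Finset.sum_mul, ← Finset.sum_mul, ← Finset.mul_sum]
  ring

/-! ### The lower bound for the probabilistic error -/

/-- The `k`-th point at which the algorithm evaluates `f`. -/
def MCAlgorithm.point {d : ℕ} {G : Set (Fin d → ℝ)} {n : ℕ} {Ω : Type*} (A : MCAlgorithm G n Ω)
    (ω : Ω) (f : (Fin d → ℝ) → ℝ) (k : ℕ) : Fin d → ℝ :=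
  A.node ω k (A.info ω f k)

/-- Even an adaptive algorithm cannot distinguish `f` from a function that agrees with it at the
points visited for `f`. -/
theorem MCAlgorithm.info_congr {d : ℕ} {G : Set (Fin d → ℝ)} {n : ℕ} {Ω : Type*}
    (A : MCAlgorithm G n Ω) (ω : Ω) {f f' : (Fin d → ℝ) → ℝ}
    (h : ∀ k < n, f' (A.point ω f k) = f (A.point ω f k)) :
    ∀ k ≤ n, A.info ω f' k = A.info ω f k := by
  intro k
  induction k with
  | zero => intro _; rfl
  | succ k ih =>
    intro hk
    have h1 := ih (by omega)
    have h2 := h k (by omega)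
    rw [MCAlgorithm.point] at h2
    simp only [MCAlgorithm.info, h1, h2]

/-- For a fixed random element, the algorithm is a decision tree on the words `s` that parametrize
combinations of functions with disjoint supports. -/
theorem MCAlgorithm.exists_observed {d : ℕ} {G : Set (Fin d → ℝ)} {n : ℕ} {Ω : Type*}
    (A : MCAlgorithm G n Ω) (ω : Ω) {ι α : Type*} [Fintype ι] [DecidableEq ι]
    {φ : ι → (Fin d → ℝ) → ℝ} (hφ : ∀ i j x, φ i x ≠ 0 → φ j x ≠ 0 → i = j) (g : α → ℝ) :
    ∃ I : (ι → α) → Finset ι, (∀ s, (I s).card ≤ n) ∧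
      ∀ s s', (∀ i ∈ I s, s' i = s i) → I s' = I s ∧
        A.run ω (fun x => ∑ i, g (s' i) * φ i x) = A.run ω (fun x => ∑ i, g (s i) * φ i x) := by
  classical
  let f : (ι → α) → (Fin d → ℝ) → ℝ := fun s x => ∑ i, g (s i) * φ i x
  -- The observed indices are those of the bumps that do not vanish at some visited point; by
  -- disjointness each point contributes at most one.
  refine ⟨fun s => (Finset.range n).biUnion fun k =>
    Finset.univ.filter fun i => φ i (A.point ω (f s) k) ≠ 0, fun s => ?_, fun s s' h => ?_⟩
  · refine (Finset.card_biUnion_le_card_mul _ _ 1 fun k _ => ?_).trans (by simp)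
    refine Finset.card_le_one.2 fun i hi j hj => ?_
    exact hφ i j _ (Finset.mem_filter.1 hi).2 (Finset.mem_filter.1 hj).2
  · have hval : ∀ k < n, f s' (A.point ω (f s) k) = f s (A.point ω (f s) k) := by
      intro k hk
      refine Finset.sum_congr rfl fun i _ => ?_
      by_cases h0 : φ i (A.point ω (f s) k) = 0
      · rw [h0, mul_zero, mul_zero]
      · rw [h i (Finset.mem_biUnion.2 ⟨k, Finset.mem_range.2 hk, by simp [h0]⟩)]
    have hinfo := A.info_congr ω hval
    refine ⟨Finset.biUnion_congr rfl fun k hk => ?_, ?_⟩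
    · have : A.point ω (f s') k = A.point ω (f s) k := by
        rw [MCAlgorithm.point, hinfo k (Finset.mem_range.1 hk).le, MCAlgorithm.point]
      rw [this]
    · change A.run ω (f s') = A.run ω (f s)
      rw [MCAlgorithm.run, hinfo n le_rfl, MCAlgorithm.run]

/-- Averaging: if, for every random element, the error exceeds `ε` on a proportion `η` of a
finite family of inputs, then it does so with probability at least `η` for one of them. -/
theorem le_of_forall_measure_le {Ω S : Type*} [MeasurableSpace Ω] [Fintype S] [Nonempty S]
    (P : Measure Ω) [IsProbabilityMeasure P] (T : Finset S) (E : S → Set Ω)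
    [∀ ω, DecidablePred fun s => ω ∈ E s]
    (hE : ∀ s ∈ T, MeasurableSet (E s)) {η δ : ℝ} (hδ : 0 ≤ δ)
    (hη : ∀ ω, η * Fintype.card S ≤ (T.filter fun s => ω ∈ E s).card)
    (hP : ∀ s ∈ T, P (E s) ≤ ENNReal.ofReal δ) : η ≤ δ := by
  have hS : (0 : ℝ) < Fintype.card S := by exact_mod_cast Fintype.card_pos
  -- The expected number of failing inputs, computed in two ways.
  have h1 : ∫⁻ ω, ∑ s ∈ T, (E s).indicator 1 ω ∂P = ∑ s ∈ T, P (E s) := by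
    rw [lintegral_finsetSum' _ fun s hs => (measurable_one.indicator (hE s hs)).aemeasurable]
    exact Finset.sum_congr rfl fun s hs => lintegral_indicator_one (hE s hs)
  have h2 : ENNReal.ofReal (η * Fintype.card S) ≤ ∫⁻ ω, ∑ s ∈ T, (E s).indicator 1 ω ∂P := by
    calc ENNReal.ofReal (η * Fintype.card S)
        = ∫⁻ _, ENNReal.ofReal (η * Fintype.card S) ∂P := by simp
      _ ≤ _ := by
          refine lintegral_mono fun ω => ?_
          refine (ENNReal.ofReal_le_ofReal (hη ω)).trans_eq ?_
          simp [indicator_apply, Finset.sum_boole]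
  have h3 : ∑ s ∈ T, P (E s) ≤ ENNReal.ofReal (δ * Fintype.card S) := by
    calc ∑ s ∈ T, P (E s) ≤ ∑ _s ∈ T, ENNReal.ofReal δ := Finset.sum_le_sum hP
      _ ≤ ∑ _s : S, ENNReal.ofReal δ := Finset.sum_le_sum_of_subset (Finset.subset_univ T)
      _ = _ := by
          rw [Finset.sum_const, nsmul_eq_mul, Finset.card_univ, ENNReal.ofReal_mul hδ,
            ENNReal.ofReal_natCast, mul_comm]
  have h4 := (h2.trans h1.le).trans h3
  rw [ENNReal.ofReal_le_ofReal_iff (by positivity)] at h4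
  exact le_of_mul_le_mul_right h4 hS

/-- This reduces integration to tails of random words: `w` sets the amplitude and `t` the deviation,
both free to be chosen according to `p`. -/
theorem le_probError_of_tail {d : ℕ} (hd : 1 ≤ d) (r : ℕ) {G : Set (Fin d → ℝ)}
    (hG : (interior G).Nonempty) :
    ∃ c : ℝ, 0 < c ∧ ∀ n : ℕ, 1 ≤ n → ∀ p : ℝ≥0∞, 1 ≤ p → ∀ (M : ℕ) (t w β δ : ℝ), 0 ≤ t →
      0 < w → 0 ≤ δ → δ < β / 2 →
      (Fintype.card (Fin (2 * n) → Fin (M + 1) × Bool) : ℝ) / 2 ≤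
        (Finset.univ.filter fun s : Fin (2 * n) → Fin (M + 1) × Bool =>
          ∑ i, |signedValue (s i)| ≤ w).card →
      (∀ F : Finset (Fin (2 * n)), n ≤ F.card →
        β * Fintype.card (Fin (2 * n) → Fin (M + 1) × Bool) ≤
          (Finset.univ.filter fun u : Fin (2 * n) → Fin (M + 1) × Bool =>
            t ≤ ∑ i ∈ F, signedValue (u i) ∧ ∑ i ∈ F, |signedValue (u i)| ≤ w).card) →
      ENNReal.ofReal (c * (n : ℝ) ^ (-((r : ℝ) / d)) / n * (n / w) ^ (1 / p.toReal) * t) ≤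
        probError.{u} G n δ (continuousSobolevSpace r p G) (sobolevNorm r p G) := by
  classical
  obtain ⟨c, hc, hsys⟩ := exists_bump_system hd r hG
  refine ⟨c, hc, fun n hn p hp M t w β δ ht hw hδ hδβ hH htail => ?_⟩
  obtain ⟨φ, J, hJ, hφ, hf⟩ := hsys n hn
  have hn0 : (0 : ℝ) < n := by exact_mod_cast hn
  set K : ℝ := (n / w : ℝ) ^ (1 / p.toReal) with hK
  have hK0 : 0 < K := by positivity
  have hJ0 : 0 < J := lt_of_lt_of_le (by positivity) hJ
  refine le_sInf ?_
  rintro _ ⟨ε, hε, rfl, Ω, _, P, _, A, hmeas, happ⟩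
  refine ENNReal.ofReal_le_ofReal ?_
  have hlow : c * (n : ℝ) ^ (-((r : ℝ) / d)) / n * K * t ≤ K * J * t := by
    rw [mul_comm K J]; gcongr
  refine hlow.trans ?_
  by_contra! hlt
  let f : (Fin (2 * n) → Fin (M + 1) × Bool) → (Fin d → ℝ) → ℝ :=
    fun s x => ∑ i, K * signedValue (s i) * φ i x
  -- Only these words give inputs known to lie in the unit ball, so failures are counted inside `T`,
  -- but as a proportion of all words.
  let T : Finset (Fin (2 * n) → Fin (M + 1) × Bool) :=
    Finset.univ.filter fun s => ∑ i, |signedValue (s i)| ≤ 2 * w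
  have hfT : ∀ s ∈ T, f s ∈ continuousSobolevSpace r p G ∧ sobolevNorm r p G (f s) ≤ 1 ∧
      ∫ x in G, f s x = K * J * ∑ i, signedValue (s i) := by
    intro s hs
    refine hf p hp w hw (fun i => signedValue (s i)) (fun i => abs_signedValue_le_one _)
      (le_trans ?_ (Finset.mem_filter.1 hs).2)
    rw [← Finset.sum_boole]
    refine Finset.sum_le_sum fun i _ => ?_
    rw [abs_signedValue]
    by_cases h2 : (s i).1 = 0
    · rw [if_pos h2]; split_ifs <;> norm_num
    · simp [signedValue, h2]
  have hle : β / 2 ≤ δ := by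
    refine le_of_forall_measure_le P T (fun s => {ω | ε < A.error (f s) ω})
      (fun s hs => measurableSet_lt measurable_const (hmeas _ (hfT s hs).1)) hδ (fun ω => ?_)
      fun s hs => happ _ (hfT s hs).1 (hfT s hs).2.1
    obtain ⟨I, hIcard, hI⟩ := A.exists_observed ω hφ
      fun a : Fin (M + 1) × Bool => K * signedValue a
    refine (decisionTree_card_error_ge signedValue (flipSign M) signedValue_flipSign n I
      (fun s => A.run ω (f s) / (K * J)) (fun s s' h => ?_) hIcard t w β (by linarith) hH
      fun F hF => htail F (by rw [Fintype.card_fin] at hF; omega)).trans ?_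
    · obtain ⟨h1, h2⟩ := hI s s' h
      exact ⟨h1, congrArg (· / (K * J)) h2⟩
    · refine Nat.cast_le.2 (Finset.card_le_card fun s hs => ?_)
      obtain ⟨hs1, hs2⟩ := (Finset.mem_filter.1 hs).2
      have hsT : s ∈ T := Finset.mem_filter.2 ⟨Finset.mem_univ _, hs2⟩
      refine Finset.mem_filter.2 ⟨hsT, ?_⟩
      change ε < |A.run ω (f s) - ∫ x in G, f s x|
      refine hlt.trans_le ?_
      rw [(hfT s hsT).2.2]
      have hKJ : 0 < K * J := mul_pos hK0 hJ0
      calc K * J * t ≤ K * J * |A.run ω (f s) / (K * J) - ∑ i, signedValue (s i)| := by gcongr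
        _ = |A.run ω (f s) - K * J * ∑ i, signedValue (s i)| := by
            nth_rewrite 1 [← abs_of_pos hKJ]
            rw [← abs_mul]
            congr 1
            field_simp
  linarith

/-! ### Choice of the parameters. -/

theorem probError_mono_space {d : ℕ} (G : Set (Fin d → ℝ)) (n : ℕ) (δ : ℝ)
    {𝓥 𝓦 : Set ((Fin d → ℝ) → ℝ)} (h : 𝓥 ⊆ 𝓦) (norm : ((Fin d → ℝ) → ℝ) → ℝ≥0∞) :
    probError.{u} G n δ 𝓥 norm ≤ probError.{u} G n δ 𝓦 norm := by
  refine sInf_le_sInf ?_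
  rintro _ ⟨ε, hε, rfl, Ω, i, P, j, A, h1, h2⟩
  exact ⟨ε, hε, rfl, Ω, i, P, j, A, fun f hf => h1 f (h hf), fun f hf => h2 f (h hf)⟩

/-- The first term of the minimum serves the capped case `k = n`, the second the case where `k` is
comparable to `log δ⁻¹`. Since `1 - 1/q` lies in `[0, 1]`, the factor `24` survives the power
uniformly in `p`. -/
theorem lowerRate_le {d r : ℕ} {p : ℝ≥0∞} (hp : 1 ≤ p) {n k : ℕ} (hn : 1 ≤ n) {δ : ℝ}
    (hL : 0 ≤ Real.log δ⁻¹) (hk : k = n ∨ Real.log δ⁻¹ ≤ 24 * k) :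
    lowerRate d r p n δ ≤ 24 * ((n : ℝ) ^ (-((r : ℝ) / d)) *
      ((k : ℝ) / n) ^ (1 - 1 / (min p 2).toReal)) := by
  have hn0 : (0 : ℝ) < n := by exact_mod_cast hn
  have hq1 : 1 ≤ (min p 2).toReal := by
    rw [← ENNReal.toReal_one]
    exact ENNReal.toReal_mono (ne_top_of_le_ne_top (by simp) (min_le_right p 2))
      (le_min hp (by norm_num))
  have hs0 : 0 ≤ 1 - 1 / (min p 2).toReal := by
    rw [sub_nonneg, div_le_one (by linarith)]; exact hq1
  have hs1 : 1 - 1 / (min p 2).toReal ≤ 1 := by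
    have : 0 ≤ 1 / (min p 2).toReal := by positivity
    linarith
  simp only [lowerRate]
  set q := (min p 2).toReal
  have hX : 0 < (n : ℝ) ^ (-((r : ℝ) / d)) := by positivity
  rcases hk with rfl | hk
  · refine (min_le_left _ _).trans ?_
    rw [div_self hn0.ne', Real.one_rpow]
    linarith
  · refine (min_le_right _ _).trans ?_
    rw [show -((r : ℝ) / d + 1 - 1 / q) = -((r : ℝ) / d) + -(1 - 1 / q) by ring,
      Real.rpow_add hn0, Real.rpow_neg hn0.le (1 - 1 / q), mul_assoc, mul_left_comm 24]
    refine mul_le_mul_of_nonneg_left ?_ hX.le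
    rw [Real.div_rpow (Nat.cast_nonneg _) hn0.le]
    have h24 : (24 : ℝ) ^ (1 - 1 / q) ≤ 24 := by
      calc (24 : ℝ) ^ (1 - 1 / q) ≤ 24 ^ (1 : ℝ) :=
            Real.rpow_le_rpow_of_exponent_le (by norm_num) hs1
        _ = 24 := Real.rpow_one _
    have h1 : Real.log δ⁻¹ ^ (1 - 1 / q) ≤ 24 * (k : ℝ) ^ (1 - 1 / q) := by
      calc Real.log δ⁻¹ ^ (1 - 1 / q) ≤ (24 * k : ℝ) ^ (1 - 1 / q) :=
            Real.rpow_le_rpow hL hk hs0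
        _ = 24 ^ (1 - 1 / q) * (k : ℝ) ^ (1 - 1 / q) :=
            Real.mul_rpow (by norm_num) (Nat.cast_nonneg _)
        _ ≤ _ := by gcongr
    calc ((n : ℝ) ^ (1 - 1 / q))⁻¹ * Real.log δ⁻¹ ^ (1 - 1 / q)
        ≤ ((n : ℝ) ^ (1 - 1 / q))⁻¹ * (24 * (k : ℝ) ^ (1 - 1 / q)) := by gcongr
      _ = _ := by ring

/-- The asymptotic lower bound, for the space of all functions in `W_p^r(G)` and also for its
continuous members only (the case of continuous representatives). The threshold and the constants
depend on `d`, `r` and `G` only. -/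
theorem mainTheorem2 (d : ℕ) (hd : 1 ≤ d) (r : ℕ) (G : Set (Fin d → ℝ))
    (hGm : NullMeasurableSet G volume) (hG : (interior G).Nonempty) :
    ∃ (n₀ : ℕ) (δ₀ c : ℝ), 0 < δ₀ ∧ δ₀ < 1 ∧ 0 < c ∧
      ∀ p : ℝ≥0∞, 1 ≤ p → ∀ n : ℕ, n₀ ≤ n → ∀ δ : ℝ, 0 < δ → δ < δ₀ →
        ENNReal.ofReal (c * lowerRate d r p n δ) ≤
          probError.{u} G n δ (sobolevSpace r p G) (sobolevNorm r p G) ∧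
        ENNReal.ofReal (c * lowerRate d r p n δ) ≤
          probError.{u} G n δ (continuousSobolevSpace r p G) (sobolevNorm r p G) := by
  obtain ⟨c, hc, hmain⟩ := le_probError_of_tail.{u} hd r hG
  -- `δ₀ = exp (-12)` ensures `⌊L / 12⌋ ≥ 1`. The loss `144 = 24 * 2 * 3` is that of the dense case;
  -- the sparse case loses only `24 * 4`.
  refine ⟨1, Real.exp (-12), c / 144, Real.exp_pos _, by rw [Real.exp_lt_one_iff]; norm_num,
    by positivity, fun p hp n hn δ hδ hδ₀ => ?_⟩
  suffices h : ENNReal.ofReal (c / 144 * lowerRate d r p n δ) ≤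
      probError.{u} G n δ (continuousSobolevSpace r p G) (sobolevNorm r p G) from
    ⟨h.trans (probError_mono_space G n δ (fun f hf => hf.1) _), h⟩
  have hn0 : (0 : ℝ) < n := by exact_mod_cast hn
  set L : ℝ := Real.log δ⁻¹ with hL
  have hδL : δ = Real.exp (-L) := by rw [hL, Real.log_inv, neg_neg, Real.exp_log hδ]
  have hL12 : 12 < L := by
    rw [hδL, Real.exp_lt_exp] at hδ₀; linarith
  obtain ⟨k, hk1, hkn, hkL, hk⟩ : ∃ k : ℕ, 1 ≤ k ∧ k ≤ n ∧ (12 * k : ℝ) ≤ L ∧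
      (k = n ∨ L ≤ 24 * k) := by
    have hfl : (⌊L / 12⌋₊ : ℝ) ≤ L / 12 := Nat.floor_le (by linarith)
    have hfl1 : 1 ≤ ⌊L / 12⌋₊ := Nat.le_floor (by push_cast; linarith)
    rcases le_total ⌊L / 12⌋₊ n with h | h
    · refine ⟨⌊L / 12⌋₊, hfl1, h, by linarith, Or.inr ?_⟩
      have h2 := Nat.lt_floor_add_one (L / 12)
      have h3 : (1 : ℝ) ≤ ⌊L / 12⌋₊ := by exact_mod_cast hfl1
      linarith
    · refine ⟨n, hn, le_rfl, ?_, Or.inl rfl⟩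
      have : (n : ℝ) ≤ ⌊L / 12⌋₊ := by exact_mod_cast h
      linarith
  have hk0 : (0 : ℝ) < k := by exact_mod_cast hk1
  -- Half of `L` pays for `6 * k`, the other half exceeds `6` and pays for the factor `1/2`.
  have hδβ : δ < Real.exp (-(6 * k)) / 2 := by
    have h1 : δ ≤ Real.exp (-(6 * k)) * Real.exp (-6) := by
      rw [hδL, ← Real.exp_add, Real.exp_le_exp]; linarith
    have h2 : Real.exp (-6) < 1 / 2 := by
      have := Real.add_one_le_exp (6 : ℝ)
      rw [Real.exp_neg, one_div]
      exact inv_strictAnti₀ (by norm_num) (by linarith)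
    nlinarith [Real.exp_pos (-(6 * k : ℝ))]
  set X : ℝ := (n : ℝ) ^ (-((r : ℝ) / d)) with hX
  have hX0 : 0 < X := by positivity
  have hrate := lowerRate_le (d := d) (r := r) hp hn (by linarith : 0 ≤ Real.log δ⁻¹) hk
  rw [← hX] at hrate
  have hp1 : 1 / p.toReal ≤ 1 := by
    rcases eq_or_ne p ⊤ with rfl | hpt
    · simp
    · have : 1 ≤ p.toReal := by
        rw [← ENNReal.toReal_one]; exact ENNReal.toReal_mono hpt hp
      rw [div_le_one (by linarith)]; exact this
  -- For `p < 2` the words are sparse, with `w = 4 * k` and `t = k`; for `p ≥ 2` all letters are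
  -- signs (`M = 0`), and `w = 2 * n` makes the conditions on `∑ |signedValue|` automatic.
  rcases lt_or_ge p 2 with hp2 | hp2
  · have hM : ∃ M, M + 1 = 2 * n / k := by
      have : 1 ≤ 2 * n / k := (Nat.le_div_iff_mul_le hk1).2 (by omega)
      exact ⟨2 * n / k - 1, by omega⟩
    obtain ⟨M, hM⟩ := hM
    refine le_trans (ENNReal.ofReal_le_ofReal ?_) (hmain n hn p hp M k (4 * k)
      (Real.exp (-(6 * k))) δ hk0.le (by positivity) hδ.le hδβ
      (half_card_le_card_sparse hk1 hkn (by simp) hM)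
      fun F hF => sparse_tail hk1 hkn (by simp) hM F hF)
    rw [min_eq_left hp2.le] at hrate
    have hpow : 1 / 4 * ((k : ℝ) / n) ^ (1 - 1 / p.toReal) ≤
        (n / (4 * k) : ℝ) ^ (1 / p.toReal) * (k / n) := by
      have h1 : (n / (4 * k) : ℝ) = 1 / 4 * ((k : ℝ) / n)⁻¹ := by field_simp
      have h2 : (1 / 4 : ℝ) ≤ (1 / 4) ^ (1 / p.toReal) := by
        calc (1 / 4 : ℝ) = (1 / 4) ^ (1 : ℝ) := (Real.rpow_one _).symm
          _ ≤ _ := Real.rpow_le_rpow_of_exponent_ge (by norm_num) (by norm_num) hp1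
      rw [h1, Real.mul_rpow (by norm_num) (by positivity), Real.inv_rpow (by positivity),
        Real.rpow_sub (by positivity), Real.rpow_one, mul_assoc]
      refine mul_le_mul h2 (le_of_eq ?_) (by positivity) (by positivity)
      rw [div_eq_inv_mul]
    calc c / 144 * lowerRate d r p n δ
        ≤ c / 144 * (24 * (X * ((k : ℝ) / n) ^ (1 - 1 / p.toReal))) := by gcongr
      _ = 2 / 3 * (c * X * (1 / 4 * ((k : ℝ) / n) ^ (1 - 1 / p.toReal))) := by ring
      _ ≤ 1 * (c * X * ((n / (4 * k) : ℝ) ^ (1 / p.toReal) * (k / n))) := by gcongr; norm_num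
      _ = _ := by ring
  · refine le_trans (ENNReal.ofReal_le_ofReal ?_) (hmain n hn p hp 0 (√(n * k) / 3) (2 * n)
      (Real.exp (-(6 * k))) δ (by positivity) (by positivity) hδ.le hδβ ?_ fun F hF => ?_)
    · rw [min_eq_right hp2, ENNReal.toReal_ofNat] at hrate
      have hpow : (1 / 2 : ℝ) ≤ (n / (2 * n) : ℝ) ^ (1 / p.toReal) := by
        have h1 : (n / (2 * n) : ℝ) = 1 / 2 := by field_simp
        rw [h1]
        calc (1 / 2 : ℝ) = (1 / 2) ^ (1 : ℝ) := (Real.rpow_one _).symm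
          _ ≤ _ := Real.rpow_le_rpow_of_exponent_ge (by norm_num) (by norm_num) hp1
      have hsq : ((k : ℝ) / n) ^ (1 - 1 / 2 : ℝ) = √(n * k) / n := by
        rw [show (1 - 1 / 2 : ℝ) = 1 / 2 by norm_num, ← Real.sqrt_eq_rpow,
          show (k : ℝ) / n = n * k / n ^ 2 by field_simp,
          Real.sqrt_div (by positivity), Real.sqrt_sq hn0.le]
      rw [hsq] at hrate
      calc c / 144 * lowerRate d r p n δ
          ≤ c / 144 * (24 * (X * (√(n * k) / n))) := by gcongr
        _ = c * X / n * (1 / 2) * (√(n * k) / 3) := by ring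
        _ ≤ _ := by gcongr
    · have hall : ∀ s : Fin (2 * n) → Fin (0 + 1) × Bool, ∑ i, |signedValue (s i)| ≤ 2 * n := by
        intro s
        calc ∑ i, |signedValue (s i)| ≤ ∑ _i : Fin (2 * n), (1 : ℝ) :=
              Finset.sum_le_sum fun i _ => abs_signedValue_le_one _
          _ = 2 * n := by simp
      rw [Finset.filter_true_of_mem fun s _ => hall s, Finset.card_univ]
      exact half_le_self (Nat.cast_nonneg _)
    · refine (dense_tail hk1 hkn F hF).trans (Nat.cast_le.2 (Finset.card_le_card fun u hu => ?_))
      refine Finset.mem_filter.2 ⟨Finset.mem_univ _, (Finset.mem_filter.1 hu).2, ?_⟩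
      calc ∑ i ∈ F, |signedValue (u i)| ≤ ∑ i, |signedValue (u i)| :=
            Finset.sum_le_sum_of_subset_of_nonneg (Finset.subset_univ _) fun _ _ _ => abs_nonneg _
        _ ≤ ∑ _i : Fin (2 * n), (1 : ℝ) := Finset.sum_le_sum fun i _ => abs_signedValue_le_one _
        _ = 2 * n := by simp
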